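/- Let $d,m\in\mathbb{N}$, let $a\le b$ be real numbers, and let $M_{d,m}(\mathbb{R})$ be the space of real $d\times m$ matrices with the operator norm $\|\cdot\|$ induced by the Euclidean norms. Let $L=(L(t))_{t\in\mathbb{R}}$ be an $\mathbb{R}^m$-valued two-sided Lévy process on a probability space $(\Omega,\mathscr{F},\mathbb{P})$, that is, $L(t)=L_1(t)$ for $t\ge 0$ and $L(t)=-L_2((-t)-)$ (left limit) for $t<0$, where $L_1,L_2$ are independent copies of a one-sided càdlàg Lévy process (stationary independent increments, continuous in probability, almost surely zero at time $0$), and assume $\mathbb{E}\|L(1)\|^2<\infty$. For $f:\mathbb{R}\to M_{d,m}(\mathbb{R})$ in $L^1\cap L^2$, the stochastic integral $\int_{\mathbb{R}}f(u)\,\mathrm{d}L(u)$ is the limit in $L^2(\Omega,\mathbb{P})$ of the sums $\int_{\mathbb{R}}\varphi_n\,\mathrm{d}L=\sum_i A_i\,(L(t_i)-L(s_i))$ for any sequence of step functions $\varphi_n=\sum_i A_i 1_{(s_i,t_i]}$ (finite sums, $A_i\in M_{d,m}(\mathbb{R})$, $s_i\le t_i$, all depending on $n$) that converges to $f$ in $L^1$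 and in $L^2$; it is determined up to almost sure equality. Theorem. Let $F:[a,b]\times\mathbb{R}\to M_{d,m}(\mathbb{R})$ be Lebesgue measurable and bounded, and assume that (i) the family $\{u\mapsto F(s,u)\}_{s\in[a,b]}$ is uniformly absolutely integrable: each $F(s,\cdot)$ is integrable on $\mathbb{R}$ and $\sup_{s\in[a,b]}\int_{|u|>N}\|F(s,u)\|\,\mathrm{d}u\to 0$ as $N\to\infty$; (ii) $F(s,u)\to 0$ as $|u|\to\infty$, uniformly in $s\in[a,b]$. Then the stochastic integrals $\int_{\mathbb{R}}F(s,u)\,\mathrm{d}L(u)$, for every $s\in[a,b]$, and $\int_{\mathbb{R}}\int_a^bF(s,u)\,\mathrm{d}s\,\mathrm{d}L(u)$ exist. There is a jointly measurable (with respect to the completed product measure $\mathrm{d}s\otimes\mathbb{P}$) process $(J(s))_{s\in[a,b]}$ such that, for almost every $s\in[a,b]$, $J(s)=\int_{\mathbb{R}}F(s,u)\,\mathrm{d}L(u)$ almost surely. For every such $J$, almost surely the path $s\mapsto J(s)$ is integrable on $[a,b]$ and $\int_a^bJ(s)\,\mathrm{d}s=\int_{\mathbb{R}}\int_a^bF(s,u)\,\mathrm{d}s\,\mathrm{d}L(u)$;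 that is, $$\int_a^b\int_{\mathbb{R}}F(s,u)\,\mathrm{d}L(u)\,\mathrm{d}s=\int_{\mathbb{R}}\int_a^bF(s,u)\,\mathrm{d}s\,\mathrm{d}L(u)\quad\text{almost surely.}$$ -/

import Mathlib

open MeasureTheory ProbabilityTheory Filter Set Topology
open scoped NNReal ENNReal Matrix Matrix.Norms.L2Operator

/-- A path indexed by `[0, ∞)` is càdlàg: right-continuous with left limits.
(At `0` the left-limit condition is void, because nothing lies to the left of `0`.) -/
def IsCadlag {E : Type*} [TopologicalSpace E] (x : ℝ≥0 → E) : Prop :=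
  (∀ t, ContinuousWithinAt x (Ici t) t) ∧ ∀ t, ∃ l, Tendsto x (𝓝[<] t) (𝓝 l)

section Levy

variable {Ω : Type*} [MeasurableSpace Ω] {m d : ℕ}

/-- A (one-sided) `ℝᵐ`-valued Lévy process `(X(t))_{t ≥ 0}`: stationary, independent increments,
continuity in probability, `X(0) = 0` almost surely; as usual, in its càdlàg modification. -/
structure IsLevyProcess (X : ℝ≥0 → Ω → EuclideanSpace ℝ (Fin m)) (P : Measure Ω) : Prop where
  measurable : ∀ t, Measurable (X t)
  indep_increments : HasIndepIncrements X P
  stationary_increments : ∀ s h : ℝ≥0,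
    IdentDistrib (fun ω => X (s + h) ω - X s ω) (fun ω => X h ω - X 0 ω) P P
  continuous_in_probability : ∀ t, TendstoInMeasure P X (𝓝 t) (X t)
  zero : ∀ᵐ ω ∂P, X 0 ω = 0
  cadlag : ∀ᵐ ω ∂P, IsCadlag (fun t => X t ω)

/-- The two-sided process `L(t) = L₁(t)` for `t ≥ 0` and `L(t) = -L₂((-t)-)` for `t < 0`, where
`L₂(r-)` denotes the left limit of `L₂` at `r`. -/
noncomputable def twoSided (L₁ L₂ : ℝ≥0 → Ω → EuclideanSpace ℝ (Fin m)) (t : ℝ) (ω : Ω) :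
    EuclideanSpace ℝ (Fin m) :=
  if 0 ≤ t then L₁ t.toNNReal ω else -Function.leftLim (fun r => L₂ r ω) (-t).toNNReal

/-- A two-sided Lévy process: obtained by `twoSided` from two independent copies of a one-sided
Lévy process. Equality in law and independence are those of the whole processes, as random
elements of `[0, ∞) → ℝᵐ` with the product σ-algebra. -/
def IsTwoSidedLevyProcess (L : ℝ → Ω → EuclideanSpace ℝ (Fin m)) (P : Measure Ω) : Prop :=
  ∃ L₁ L₂ : ℝ≥0 → Ω → EuclideanSpace ℝ (Fin m),
    IsLevyProcess L₁ P ∧ IsLevyProcess L₂ P ∧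
    IdentDistrib (fun ω t => L₁ t ω) (fun ω t => L₂ t ω) P P ∧
    IndepFun (fun ω t => L₁ t ω) (fun ω t => L₂ t ω) P ∧
    L = twoSided L₁ L₂

/-- A matrix-valued step function on `ℝ`, given as `∑ i, A i • 1_{(s i, t i]}`. -/
structure StepFun (d m : ℕ) where
  n : ℕ
  s : Fin n → ℝ
  t : Fin n → ℝ
  le : ∀ i, s i ≤ t i
  A : Fin n → Matrix (Fin d) (Fin m) ℝ

/-- The function `∑ i, A i • 1_{(s i, t i]}`. -/
noncomputable def StepFun.toFun (φ : StepFun d m) (u : ℝ) : Matrix (Fin d) (Fin m) ℝ :=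
  ∑ i, (Ioc (φ.s i) (φ.t i)).indicator (fun _ => φ.A i) u

/-- The elementary stochastic integral `∫ φ dL = ∑ i, A i (L(t i) - L(s i))`. -/
noncomputable def StepFun.integral (φ : StepFun d m) (L : ℝ → Ω → EuclideanSpace ℝ (Fin m))
    (ω : Ω) : EuclideanSpace ℝ (Fin d) :=
  ∑ i, WithLp.toLp 2 (φ.A i *ᵥ (L (φ.t i) ω - L (φ.s i) ω).ofLp)

/-- The step functions `φ n` converge to `f` both in `L¹(ℝ)` and in `L²(ℝ)`. -/
def StepFun.Approximates (φ : ℕ → StepFun d m) (f : ℝ → Matrix (Fin d) (Fin m) ℝ) : Prop :=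
  Tendsto (fun n => eLpNorm ((φ n).toFun - f) 1 volume) atTop (𝓝 0) ∧
  Tendsto (fun n => eLpNorm ((φ n).toFun - f) 2 volume) atTop (𝓝 0)

/-- `I` is (a version of) the stochastic integral `∫_ℝ f(u) dL(u)` of the deterministic integrand
`f ∈ L¹(ℝ) ∩ L²(ℝ)` with respect to the process `L` with finite second moments: it is the
`L²(P)`-limit of the elementary integrals `∫ φ n dL`, for every sequence of step functions `φ n`
converging to `f` in `L¹ ∩ L²` (and there is such a sequence). Convergence in `L²(ℝ)` controls the
centred part of `L`, and convergence in `L¹(ℝ)` its drift `t ↦ t * E L(1)`. -/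
structure IsLevyIntegral (L : ℝ → Ω → EuclideanSpace ℝ (Fin m)) (P : Measure Ω)
    (f : ℝ → Matrix (Fin d) (Fin m) ℝ) (I : Ω → EuclideanSpace ℝ (Fin d)) : Prop where
  integrable : Integrable f volume
  memLp_two : MemLp f 2 volume
  memLp : MemLp I 2 P
  exists_approx : ∃ φ : ℕ → StepFun d m, StepFun.Approximates φ f
  tendsto : ∀ φ : ℕ → StepFun d m, StepFun.Approximates φ f →
    Tendsto (fun n => eLpNorm ((φ n).integral L - I) 2 P) atTop (𝓝 0)

/-- The stochastic integral `∫_ℝ f(u) dL(u)` exists (as an element of `L²(P)`). -/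
def LevyIntegrable (L : ℝ → Ω → EuclideanSpace ℝ (Fin m)) (P : Measure Ω)
    (f : ℝ → Matrix (Fin d) (Fin m) ℝ) : Prop :=
  ∃ I : Ω → EuclideanSpace ℝ (Fin d), IsLevyIntegral L P f I

open scoped Classical in
/-- The stochastic integral `∫_ℝ f(u) dL(u)`, determined up to almost sure equality
(and `0` if it does not exist). -/
noncomputable def levyIntegral (L : ℝ → Ω → EuclideanSpace ℝ (Fin m)) (P : Measure Ω)
    (f : ℝ → Matrix (Fin d) (Fin m) ℝ) : Ω → EuclideanSpace ℝ (Fin d) :=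
  if h : LevyIntegrable L P f then h.choose else 0

/-- `J` is a jointly measurable version, on the time interval `[a, b]`, of the process
`s ↦ ∫_ℝ F(s,u) dL(u)`, each member of which is only determined up to almost sure equality. -/
def IsMeasurableVersion (L : ℝ → Ω → EuclideanSpace ℝ (Fin m)) (P : Measure Ω) (a b : ℝ)
    (F : ℝ → ℝ → Matrix (Fin d) (Fin m) ℝ) (J : ℝ → Ω → EuclideanSpace ℝ (Fin d)) : Prop :=
  AEStronglyMeasurable (Function.uncurry J) ((volume.restrict (Icc a b)).prod P) ∧
  ∀ᵐ s ∂volume.restrict (Icc a b), J s =ᵐ[P] levyIntegral L P (F s)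

/-- The family `{u ↦ F(s,u)}_{s ∈ S}` is uniformly absolutely integrable: every member is
absolutely integrable, and `sup_{s ∈ S} ∫_{|u| > N} ‖F(s,u)‖ du → 0` as `N → ∞`. -/
def UniformlyAbsolutelyIntegrableOn (F : ℝ → ℝ → Matrix (Fin d) (Fin m) ℝ) (S : Set ℝ) : Prop :=
  (∀ s ∈ S, Integrable (F s) volume) ∧
  ∀ ε > 0, ∃ N₀ : ℝ, ∀ N ≥ N₀, ∀ s ∈ S, ∫ u in {u : ℝ | N < |u|}, ‖F s u‖ ≤ ε

end Levy

/-- The stochastic integral is unique up to almost sure equality. -/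
theorem IsLevyIntegral.ae_eq {Ω : Type*} [MeasurableSpace Ω] {m d : ℕ}
    {L : ℝ → Ω → EuclideanSpace ℝ (Fin m)} {P : Measure Ω}
    (hL : ∀ t, AEStronglyMeasurable (L t) P)
    {f : ℝ → Matrix (Fin d) (Fin m) ℝ} {I J : Ω → EuclideanSpace ℝ (Fin d)}
    (hI : IsLevyIntegral L P f I) (hJ : IsLevyIntegral L P f J) : I =ᵐ[P] J := by
  obtain ⟨φ, hφ⟩ := hI.exists_approx
  have hm : ∀ n, AEStronglyMeasurable ((φ n).integral L) P := by
    intro n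
    unfold StepFun.integral
    refine Finset.aestronglyMeasurable_fun_sum _ fun i _ => ?_
    have hc : Continuous (fun x : EuclideanSpace ℝ (Fin m) =>
        (WithLp.toLp 2 ((φ n).A i *ᵥ x.ofLp) : EuclideanSpace ℝ (Fin d))) := by fun_prop
    exact hc.comp_aestronglyMeasurable ((hL _).sub (hL _))
  have h1 := tendstoInMeasure_of_tendsto_eLpNorm (by norm_num) hm hI.memLp.1 (hI.tendsto φ hφ)
  have h2 := tendstoInMeasure_of_tendsto_eLpNorm (by norm_num) hm hJ.memLp.1 (hJ.tendsto φ hφ)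
  exact tendstoInMeasure_ae_unique h1 h2

/-! For deterministic integrands, the stochastic integral is a bounded linear operator plus a drift,
and Fubini's theorem survives composition with a bounded operator on `L²`.

Each coordinate of `L` has mean `t * μ` and, its increments being stationary and independent,
covariance `v` times the `L²(ℝ)` inner product of signed indicators
(`IsTwoSidedLevyProcess.hasLevyMoments`). Hence sending `1_{(s, t]}` to the centred increment
preserves inner products up to the factor `v`, and extends to a continuous `Φ : L²(ℝ) → L²(P)`
(`HasLevyMoments.exists_centredIntegral`). The integral of a scalar `f` is `Φ f + μ ∫ f`; matrices
are treated entry by entry (`isLevyIntegral_of_ae_eq`), and correlation between coordinates plays no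
role.

A measurable family `F s` in `L²(ℝ)` has a jointly measurable version `J s` of `Φ (F s)`
(`exists_stronglyMeasurable_version`). Over an event `A`, the integral of `J s` is the pairing of `F
s` with `Φ* 1_A`, so the interchange reduces to classical Fubini on `ds ⊗ P` and on `ds ⊗ du`
(`integral_version_ae_eq`). The drift needs only classical Fubini. Finally, jointly measurable
versions agree almost everywhere on the product, so the identity passes from one version to all. -/

/-! ### Moments of a one-sided Lévy process -/

/-- An additive function on `[0, ∞)` that is bounded near `0` is linear. -/
theorem eq_mul_one_of_additive_of_bounded {f : ℝ≥0 → ℝ} (hadd : ∀ s t, f (s + t) = f s + f t)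
    {δ : ℝ≥0} (hδ : 0 < δ) {B : ℝ} (hB : ∀ t < δ, |f t| ≤ B) (t : ℝ≥0) : f t = t * f 1 := by
  have hzero : f 0 = 0 := by simpa using hadd 0 0
  have hsmul : ∀ (n : ℕ) t, f (n * t) = n * f t := by
    intro n t
    induction n with
    | zero => simp [hzero]
    | succ n ih => push_cast; rw [add_mul, hadd, ih, one_mul]; ring
  -- Boundedness spreads from `[0, δ)` to `[0, 1]` through `f r = N * f (r / N)`.
  obtain ⟨N, hN⟩ := exists_nat_gt (1 / δ)
  have hN0 : (0 : ℝ≥0) < N := lt_of_le_of_lt (by positivity) hN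
  have hunit : ∀ r ≤ (1 : ℝ≥0), |f r| ≤ N * B := by
    intro r hr
    have h1 : r / N < δ := by
      rw [div_lt_iff₀ hN0]
      rw [div_lt_iff₀ hδ] at hN
      calc r ≤ 1 := hr
        _ < N * δ := hN
        _ = δ * N := mul_comm _ _
    have h2 : f r = N * f (r / N) := by
      rw [← hsmul, mul_div_cancel₀ _ hN0.ne']
    rw [h2, abs_mul, Nat.abs_cast]
    exact mul_le_mul_of_nonneg_left (hB _ h1) (Nat.cast_nonneg _)
  by_contra hne
  have hpos : 0 < |f t - t * f 1| := abs_pos.2 (sub_ne_zero.2 hne)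
  -- With `k = ⌊n t⌋` and `r = n t - k ≤ 1`, the quantity `n (f t - t f 1) = f r - r f 1` is bounded
  -- independently of `n`, which is absurd for large `n` unless `f t = t f 1`.
  obtain ⟨n, hn⟩ := exists_nat_gt ((N * B + |f 1|) / |f t - t * f 1|)
  rw [div_lt_iff₀ hpos] at hn
  set k := ⌊(n : ℝ≥0) * t⌋₊
  have hk : (k : ℝ≥0) ≤ n * t := Nat.floor_le zero_le
  set r : ℝ≥0 := n * t - k
  have hr : (n : ℝ≥0) * t = k * 1 + r := by rw [mul_one, add_tsub_cancel_of_le hk]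
  have hr1 : r ≤ 1 := by
    rw [tsub_le_iff_left]
    exact (Nat.lt_floor_add_one _).le
  have h3 : (n : ℝ) * f t = k * f 1 + f r := by rw [← hsmul, hr, hadd, hsmul]
  have h4 : (n : ℝ) * t = k + r := by
    have := congrArg NNReal.toReal hr
    push_cast at this
    linarith
  have h5 : (n : ℝ) * (f t - t * f 1) = f r - r * f 1 := by
    linear_combination h3 - f 1 * h4
  have h6 : |f r - r * f 1| ≤ N * B + |f 1| := by
    refine (abs_sub _ _).trans (add_le_add (hunit r hr1) ?_)
    rw [abs_mul, NNReal.abs_eq]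
    exact mul_le_of_le_one_left (abs_nonneg _) (by exact_mod_cast hr1)
  rw [← h5, abs_mul, Nat.abs_cast] at h6
  linarith

section Moments

variable {Ω : Type*} [MeasurableSpace Ω] {P : Measure Ω}

/-- A summand of a sum of two independent random variables inherits `p`-integrability. -/
theorem ProbabilityTheory.IndepFun.memLp_left_of_memLp_add [IsProbabilityMeasure P]
    {X Y : Ω → ℝ} {p : ℝ≥0∞}
    (hp0 : p ≠ 0) (hp : p ≠ ∞)
    (h : IndepFun X Y P) (hX : AEMeasurable X P) (hY : AEMeasurable Y P)
    (hXY : MemLp (X + Y) p P) : MemLp X p P := by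
  have hmap := (indepFun_iff_map_prod_eq_prod_map_map hX hY).1 h
  have := Measure.isProbabilityMeasure_map (μ := P) hX
  have := Measure.isProbabilityMeasure_map (μ := P) hY
  have h1 : MemLp (fun z : ℝ × ℝ => z.1 + z.2) p ((P.map X).prod (P.map Y)) := by
    rw [← hmap, memLp_map_measure_iff (by fun_prop) (hX.prodMk hY)]
    exact hXY
  have h2 : Integrable (fun z : ℝ × ℝ => ‖z.1 + z.2‖ ^ p.toReal) ((P.map X).prod (P.map Y)) :=
    h1.integrable_norm_rpow hp0 hp
  -- By Fubini, `x ↦ x + y` is in `L^p` of the law of `X` for almost every value `y` of `Y`. One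
  -- such `y` suffices, since constants are in `L^p`.
  obtain ⟨y, hy⟩ := h2.prod_left_ae.exists
  have h3 : MemLp (fun x : ℝ => x + y) p (P.map X) :=
    (integrable_norm_rpow_iff (by fun_prop) hp0 hp).1 hy
  have h4 : MemLp (fun x : ℝ => x) p (P.map X) := by
    convert! h3.sub (memLp_const y) using 1
    ext x
    simp
  rw [memLp_map_measure_iff (by fun_prop) hX] at h4
  exact h4

/-- A real Lévy process (in law) with finite second moments. -/
structure IsSquareIntegrableLevy (Z : ℝ≥0 → Ω → ℝ) (P : Measure Ω) : Prop where
  measurable : ∀ t, Measurable (Z t)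
  indep_increments : HasIndepIncrements Z P
  stationary_increments : ∀ s h : ℝ≥0,
    IdentDistrib (fun ω => Z (s + h) ω - Z s ω) (fun ω => Z h ω - Z 0 ω) P P
  continuous_in_probability : TendstoInMeasure P Z (𝓝 0) (Z 0)
  zero : ∀ᵐ ω ∂P, Z 0 ω = 0
  memLp_one : MemLp (Z 1) 2 P

namespace IsSquareIntegrableLevy

variable {Z : ℝ≥0 → Ω → ℝ}

theorem identDistrib_sub (h : IsSquareIntegrableLevy Z P) (s t : ℝ≥0) :
    IdentDistrib (Z (s + t) - Z s) (Z t) P P := by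
  refine (h.stationary_increments s t).trans (IdentDistrib.of_ae_eq ?_ ?_)
  · exact ((h.measurable t).sub (h.measurable 0)).aemeasurable
  · filter_upwards [h.zero] with ω hω
    simp [hω]

theorem indepFun_sub (h : IsSquareIntegrableLevy Z P) {s t : ℝ≥0} (hst : s ≤ t) :
    IndepFun (Z s) (Z t - Z s) P :=
  h.indep_increments.indepFun_eval_sub zero_le hst h.zero

variable [IsProbabilityMeasure P]

/-- Integer times follow by adding increments distributed as `Z 1`. For `t ≤ n`, `Z t` is an
independent summand of `Z n = Z t + (Z n - Z t)`. -/
theorem memLp (h : IsSquareIntegrableLevy Z P) (t : ℝ≥0) : MemLp (Z t) 2 P := by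
  have hnat : ∀ n : ℕ, MemLp (Z n) 2 P := by
    intro n
    induction n with
    | zero =>
      refine MemLp.ae_eq (f := fun _ => (0 : ℝ)) ?_ (by simp)
      filter_upwards [h.zero] with ω hω
      simp [hω]
    | succ n ih =>
      have h1 := (h.identDistrib_sub n 1).memLp_iff.2 h.memLp_one
      simpa using ih.add h1
  obtain ⟨n, hn⟩ := exists_nat_ge t
  refine (h.indepFun_sub hn).memLp_left_of_memLp_add (by simp) (by simp)
    (h.measurable _).aemeasurable ((h.measurable _).sub (h.measurable _)).aemeasurable ?_
  simpa using hnat n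

/-- The variance is additive in time and nonnegative, hence bounded by `Var[Z 1]` on `[0, 1)`. -/
theorem variance_eq (h : IsSquareIntegrableLevy Z P) (t : ℝ≥0) : Var[Z t; P] = t * Var[Z 1; P] := by
  have hadd : ∀ s t, Var[Z (s + t); P] = Var[Z s; P] + Var[Z t; P] := by
    intro s t
    have h1 := IndepFun.variance_add (h.memLp s) ((h.memLp (s + t)).sub (h.memLp s))
      (h.indepFun_sub le_self_add)
    rw [add_sub_cancel] at h1
    rw [h1, (h.identDistrib_sub s t).variance_eq]
  refine eq_mul_one_of_additive_of_bounded (f := fun t => Var[Z t; P]) hadd one_pos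
    (B := Var[Z 1; P]) (fun r hr => ?_) t
  rw [abs_of_nonneg (variance_nonneg _ _)]
  have := hadd r (1 - r)
  rw [add_tsub_cancel_of_le hr.le] at this
  linarith [variance_nonneg (Z (1 - r)) P]

/-- The mean is additive, so only boundedness near `0` is at stake. For small `r`, continuity in
probability places `Z r` within `1` of `0`, and Chebyshev places it within `K` of its mean, each
outside an event of probability at most `1 / 4`. Both hold somewhere, so the mean is at most `K + 1`
in absolute value. -/
theorem integral_eq (h : IsSquareIntegrableLevy Z P) (t : ℝ≥0) :
    (∫ ω, Z t ω ∂P) = t * (∫ ω, Z 1 ω ∂P) := by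
  have hint : ∀ t, Integrable (Z t) P := fun t => (h.memLp t).integrable one_le_two
  have hadd : ∀ s t, (∫ ω, Z (s + t) ω ∂P) = (∫ ω, Z s ω ∂P) + (∫ ω, Z t ω ∂P) := by
    intro s t
    have h1 := (h.identDistrib_sub s t).integral_eq
    have h2 : (∫ ω, (Z (s + t) - Z s) ω ∂P) = (∫ ω, Z (s + t) ω ∂P) - (∫ ω, Z s ω ∂P) :=
      integral_sub (hint _) (hint _)
    linarith
  -- `K ^ 2 ≥ 4 Var[Z 1]` makes the Chebyshev bound at most `1 / 4`; the summand `2` keeps `K`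
  -- positive when the variance vanishes.
  set K : ℝ := 2 * √(Var[Z 1; P]) + 2
  have hK : 0 < K := by positivity
  have hKv : Var[Z 1; P] / K ^ 2 ≤ 1 / 4 := by
    rw [div_le_iff₀ (by positivity)]
    nlinarith [Real.sq_sqrt (variance_nonneg (Z 1) P), Real.sqrt_nonneg (Var[Z 1; P])]
  have hc := h.continuous_in_probability 1 one_pos
  have hev : ∀ᶠ t in 𝓝 (0 : ℝ≥0), P {ω | 1 ≤ edist (Z t ω) (Z 0 ω)} < ENNReal.ofReal (1 / 4) :=
    hc.eventually (gt_mem_nhds (by simp))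
  obtain ⟨δ, hδ, hδs⟩ := exists_Ico_subset_of_mem_nhds' hev one_pos
  refine eq_mul_one_of_additive_of_bounded (f := fun t => (∫ ω, Z t ω ∂P)) hadd hδ.1
    (B := K + 1) (fun r hr => ?_) t
  have h1 := hδs ⟨zero_le, hr⟩
  have h2 := meas_ge_le_variance_div_sq (h.memLp r) hK
  have h3 : Var[Z r; P] / K ^ 2 ≤ 1 / 4 := by
    refine le_trans ?_ hKv
    gcongr
    rw [h.variance_eq r]
    exact mul_le_of_le_one_left (variance_nonneg _ _) (by exact_mod_cast hr.le.trans hδ.2)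
  have h4 := h2.trans (ENNReal.ofReal_le_ofReal h3)
  by_contra hlt
  rw [not_le] at hlt
  have hcover : P univ ≤ P ({ω | 1 ≤ edist (Z r ω) (Z 0 ω)} ∪ {ω | K ≤ |Z r ω - (∫ ω, Z r ω ∂P)|}) := by
    refine measure_mono_ae ?_
    filter_upwards [h.zero] with ω hω _
    by_contra hcon
    change ω ∉ {ω | 1 ≤ edist (Z r ω) (Z 0 ω)} ∪ {ω | K ≤ |Z r ω - ∫ ω, Z r ω ∂P|} at hcon
    rw [mem_union, not_or] at hcon
    obtain ⟨h5, h6⟩ := hcon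
    rw [mem_ofPred_eq, not_le] at h5 h6
    rw [hω, edist_dist, Real.dist_eq, sub_zero, ENNReal.ofReal_lt_one] at h5
    have h7 := abs_sub_abs_le_abs_sub ((∫ ω, Z r ω ∂P)) (Z r ω)
    rw [abs_sub_comm] at h7
    linarith
  have h8 := hcover.trans (measure_union_le _ _)
  have h9 : P {ω | 1 ≤ edist (Z r ω) (Z 0 ω)} + P {ω | K ≤ |Z r ω - (∫ ω, Z r ω ∂P)|} ≤
      ENNReal.ofReal (1 / 4) + ENNReal.ofReal (1 / 4) := add_le_add (le_of_lt h1) h4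
  rw [← ENNReal.ofReal_add (by norm_num) (by norm_num)] at h9
  have h10 := h8.trans h9
  rw [measure_univ, ENNReal.one_le_ofReal] at h10
  norm_num at h10

theorem covariance_eq (h : IsSquareIntegrableLevy Z P) (s t : ℝ≥0) : cov[Z s, Z t; P] = (min s t : ℝ≥0) * Var[Z 1; P] := by
  have key : ∀ s t : ℝ≥0, s ≤ t → cov[Z s, Z t; P] = s * Var[Z 1; P] := by
    intro s t hst
    have h1 := (h.indepFun_sub hst).covariance_eq_zero (h.memLp s) ((h.memLp t).sub (h.memLp s))
    rw [covariance_sub_right (h.memLp s) (h.memLp t) (h.memLp s),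
      covariance_self (h.measurable s).aemeasurable, h.variance_eq] at h1
    linarith
  rcases le_total s t with hst | hst
  · rw [min_eq_left hst, key s t hst]
  · rw [min_eq_right hst, covariance_comm, key t s hst]

end IsSquareIntegrableLevy

end Moments

/-! ### The covariance kernel of a two-sided Lévy process -/

/-- The function `1_{(0, t]}` for `t ≥ 0` and `-1_{(t, 0]}` for `t < 0`. -/
noncomputable def signedIndicator (t : ℝ) : ℝ → ℝ :=
  (Ioc 0 t).indicator 1 - (Ioc t 0).indicator 1

theorem signedIndicator_sub {s t : ℝ} (hst : s ≤ t) :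
    signedIndicator t - signedIndicator s = (Ioc s t).indicator 1 := by
  ext u
  simp only [signedIndicator, Pi.sub_apply, indicator_apply, mem_Ioc, Pi.one_apply]
  grind

theorem memLp_signedIndicator (t : ℝ) (p : ℝ≥0∞) : MemLp (signedIndicator t) p volume := by
  refine MemLp.sub ?_ ?_ <;>
  exact memLp_indicator_const p measurableSet_Ioc (1 : ℝ) (Or.inr (by simp))

theorem integral_signedIndicator (t : ℝ) : ∫ u, signedIndicator t u = t := by
  simp only [signedIndicator, Pi.sub_apply]
  rw [integral_sub, integral_indicator_one measurableSet_Ioc,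
    integral_indicator_one measurableSet_Ioc]
  · simp only [Real.volume_real_Ioc]
    grind
  all_goals exact (integrable_indicator_iff measurableSet_Ioc).2 (by simp [Pi.one_def])

/-- This is the covariance kernel of two independent branches of unit variance, so `signedIndicator
t` is the model in `L²(ℝ)` of the centred value at time `t`. -/
theorem integral_signedIndicator_mul (s t : ℝ) :
    ∫ u, signedIndicator s u * signedIndicator t u =
      if 0 ≤ s ∧ 0 ≤ t then min s t else if s < 0 ∧ t < 0 then min (-s) (-t) else 0 := by
  split_ifs with h1 h2
  · have h : ∀ u, signedIndicator s u * signedIndicator t u = signedIndicator (min s t) u := by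
      intro u
      simp only [signedIndicator, Pi.sub_apply, indicator_apply, mem_Ioc, Pi.one_apply]
      grind
    simp_rw [h, integral_signedIndicator]
  · have h : ∀ u, signedIndicator s u * signedIndicator t u = -signedIndicator (max s t) u := by
      intro u
      simp only [signedIndicator, Pi.sub_apply, indicator_apply, mem_Ioc, Pi.one_apply]
      grind
    simp_rw [h, integral_neg, integral_signedIndicator]
    grind
  · have h : ∀ u, signedIndicator s u * signedIndicator t u = 0 := by
      intro u
      simp only [signedIndicator, Pi.sub_apply, indicator_apply, mem_Ioc, Pi.one_apply]
      grind
    simp [h]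

/-- A real process with finite second moments and the first and second order structure of a
two-sided Lévy process. -/
structure HasLevyMoments {Ω : Type*} [MeasurableSpace Ω] (Z : ℝ → Ω → ℝ) (P : Measure Ω)
    (μ v : ℝ) : Prop where
  memLp : ∀ t, MemLp (Z t) 2 P
  integral_eq : ∀ t, ∫ ω, Z t ω ∂P = t * μ
  covariance_eq : ∀ s t,
    cov[Z s, Z t; P] = v * ∫ u, signedIndicator s u * signedIndicator t u

section TwoSided

variable {Ω : Type*} [MeasurableSpace Ω] {P : Measure Ω} {m : ℕ}

theorem IsLevyProcess.isSquareIntegrableLevy {X : ℝ≥0 → Ω → EuclideanSpace ℝ (Fin m)}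
    (hX : IsLevyProcess X P) (hX1 : MemLp (X 1) 2 P) (j : Fin m) :
    IsSquareIntegrableLevy (fun t ω => X t ω j) P where
  measurable t := by have := hX.measurable t; fun_prop
  indep_increments := hX.indep_increments.map (EuclideanSpace.proj (𝕜 := ℝ) j)
  stationary_increments s h :=
    (hX.stationary_increments s h).comp (u := fun x : EuclideanSpace ℝ (Fin m) => x j)
      (by fun_prop)
  continuous_in_probability := by
    intro ε hε
    refine tendsto_of_tendsto_of_tendsto_of_le_of_le tendsto_const_nhds
      (hX.continuous_in_probability 0 ε hε) (fun _ => zero_le) fun t => ?_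
    refine measure_mono fun ω hω => ?_
    refine le_trans (mem_ofPred_eq.mp hω) ?_
    rw [edist_dist, edist_dist]
    refine ENNReal.ofReal_le_ofReal ?_
    rw [dist_eq_norm, dist_eq_norm]
    exact PiLp.norm_apply_le (X t ω - X 0 ω) j
  zero := by
    filter_upwards [hX.zero] with ω hω
    simp [hω]
  memLp_one := (EuclideanSpace.proj (𝕜 := ℝ) j).comp_memLp' hX1

/-- At a fixed time `t > 0`, a Lévy process has almost surely no jump. -/
theorem IsLevyProcess.leftLim_ae_eq [IsProbabilityMeasure P]
    {X : ℝ≥0 → Ω → EuclideanSpace ℝ (Fin m)}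
    (hX : IsLevyProcess X P) {t : ℝ≥0} (ht : 0 < t) :
    (fun ω => Function.leftLim (fun r => X r ω) t) =ᵐ[P] X t := by
  obtain ⟨u, -, hut, hu⟩ := exists_seq_strictMono_tendsto' ht
  have hu' : Tendsto u atTop (𝓝[<] t) :=
    tendsto_nhdsWithin_of_tendsto_nhds_of_eventually_within _ hu (.of_forall fun n => (hut n).2)
  -- Along `u n ↑ t`, `X (u n)` tends almost surely to the left limit and in probability to `X t`.
  refine tendstoInMeasure_ae_unique (f := fun n => X (u n)) (u := atTop)
    (tendstoInMeasure_of_tendsto_ae (fun n => (hX.measurable _).aestronglyMeasurable) ?_)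
    (fun ε hε => (hX.continuous_in_probability t ε hε).comp hu)
  filter_upwards [hX.cadlag] with ω hω
  exact (tendsto_leftLim_of_tendsto (hω.2 t)).comp hu'

/-- Left limits on the negative half-line can be dropped almost surely at each fixed time. Equality
in law gives both branches the same `μ` and `v`, independence kills the mixed covariances, and the
two signs cancel on the negative side. -/
theorem IsTwoSidedLevyProcess.hasLevyMoments [IsProbabilityMeasure P]
    {L : ℝ → Ω → EuclideanSpace ℝ (Fin m)}
    (hL : IsTwoSidedLevyProcess L P) (hL1 : MemLp (L 1) 2 P) (j : Fin m) :
    ∃ μ v : ℝ, 0 ≤ v ∧ HasLevyMoments (fun t ω => L t ω j) P μ v := by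
  obtain ⟨X, Y, hX, hY, hXY, hind, rfl⟩ := hL
  have hX1 : MemLp (X 1) 2 P := by
    refine hL1.ae_eq (.of_forall fun ω => ?_)
    simp [twoSided]
  have hY1 : MemLp (Y 1) 2 P := by
    have := hXY.comp (u := fun x : ℝ≥0 → EuclideanSpace ℝ (Fin m) => x 1) (by fun_prop)
    exact this.memLp_iff.1 hX1
  have hXj := hX.isSquareIntegrableLevy hX1 j
  have hYj := hY.isSquareIntegrableLevy hY1 j
  have hid : IdentDistrib (fun ω => X 1 ω j) (fun ω => Y 1 ω j) P P :=
    hXY.comp (u := fun x : ℝ≥0 → EuclideanSpace ℝ (Fin m) => x 1 j) (by fun_prop)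
  have hindep : ∀ s t, IndepFun (fun ω => X s ω j) (fun ω => Y t ω j) P := fun s t =>
    hind.comp (φ := fun x : ℝ≥0 → EuclideanSpace ℝ (Fin m) => x s j)
      (ψ := fun x : ℝ≥0 → EuclideanSpace ℝ (Fin m) => x t j) (by fun_prop) (by fun_prop)
  have hpos : ∀ t : ℝ, 0 ≤ t → (fun ω => twoSided X Y t ω j) = fun ω => X t.toNNReal ω j := by
    intro t ht
    ext ω
    simp [twoSided, ht]
  have hneg : ∀ t : ℝ, t < 0 →
      (fun ω => twoSided X Y t ω j) =ᵐ[P] -fun ω => Y (-t).toNNReal ω j := by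
    intro t ht
    filter_upwards [hY.leftLim_ae_eq (t := (-t).toNNReal) (by simpa using ht)] with ω hω
    simp [twoSided, ht.not_ge, hω]
  have hcongr : ∀ {U U' V V' : Ω → ℝ}, U =ᵐ[P] U' → V =ᵐ[P] V' →
      cov[U, V; P] = cov[U', V'; P] := by
    intro U U' V V' hU hV
    unfold covariance
    rw [integral_congr_ae hU, integral_congr_ae hV]
    refine integral_congr_ae ?_
    filter_upwards [hU, hV] with ω h1 h2
    rw [h1, h2]
  refine ⟨∫ ω, X 1 ω j ∂P, Var[fun ω => X 1 ω j; P], variance_nonneg _ _,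
    fun t => ?_, fun t => ?_, fun s t => ?_⟩
  · rcases le_or_gt 0 t with ht | ht
    · rw [hpos t ht]
      exact hXj.memLp _
    · exact (memLp_congr_ae (hneg t ht)).2 (hYj.memLp _).neg
  · rcases le_or_gt 0 t with ht | ht
    · rw [hpos t ht, hXj.integral_eq, Real.coe_toNNReal t ht]
    · rw [integral_congr_ae (hneg t ht)]
      simp only [Pi.neg_apply]
      rw [integral_neg, hYj.integral_eq, Real.coe_toNNReal (-t) (by linarith), hid.integral_eq]
      ring
  · rw [integral_signedIndicator_mul]
    rcases le_or_gt 0 s with hs | hs <;> rcases le_or_gt 0 t with ht | ht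
    · rw [hpos s hs, hpos t ht, hXj.covariance_eq, if_pos ⟨hs, ht⟩, NNReal.coe_min,
        Real.coe_toNNReal t ht, Real.coe_toNNReal s hs, mul_comm]
    · rw [hcongr (.of_forall (congrFun (hpos s hs))) (hneg t ht), covariance_neg_right,
        (hindep _ _).covariance_eq_zero (hXj.memLp _) (hYj.memLp _),
        if_neg (by grind), if_neg (by grind)]
      simp
    · rw [hcongr (hneg s hs) (.of_forall (congrFun (hpos t ht))), covariance_neg_left,
        (hindep _ _).symm.covariance_eq_zero (hYj.memLp _) (hXj.memLp _),
        if_neg (by grind), if_neg (by grind)]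
      simp
    · rw [hcongr (hneg s hs) (hneg t ht), covariance_neg_left, covariance_neg_right, neg_neg,
        hYj.covariance_eq, if_neg (by grind), if_pos ⟨hs, ht⟩, NNReal.coe_min,
        Real.coe_toNNReal (-t) (by linarith), Real.coe_toNNReal (-s) (by linarith), mul_comm,
        hid.variance_eq]

end TwoSided

/-! ### Density of step functions in `L¹ ∩ L²` -/

/-- A continuous function with compact support is uniformly approximated on `(-N, N]` by a step
function that vanishes outside `(-N, N]`. -/
theorem exists_step_uniform_approx {E : Type*} [NormedAddCommGroup E] {g : ℝ → E}
    (hg : UniformContinuous g) (N : ℕ) {η : ℝ} (hη : 0 < η) :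
    ∃ (n : ℕ) (s t : Fin n → ℝ) (A : Fin n → E), (∀ i, s i ≤ t i) ∧
      (∀ u ∈ Ioc (-N : ℝ) N, ‖∑ i, (Ioc (s i) (t i)).indicator (fun _ => A i) u - g u‖ ≤ η) ∧
      ∀ u ∉ Ioc (-N : ℝ) N, ∑ i, (Ioc (s i) (t i)).indicator (fun _ => A i) u = 0 := by
  obtain ⟨δ, hδ, hgδ⟩ := Metric.uniformContinuous_iff.1 hg η hη
  obtain ⟨M, hM⟩ := exists_nat_gt (1 / δ)
  have hM0 : (0 : ℝ) < M := lt_trans (by positivity) hM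
  have hMδ : 1 / (M : ℝ) < δ := by
    rw [div_lt_iff₀ hM0]
    rw [div_lt_iff₀ hδ] at hM
    linarith
  -- The grid has mesh `1 / M < δ`. The cells are half-open, so `u` can only lie in the cell of
  -- index `⌈u * M⌉ - 1 + N * M`, and at most one summand is nonzero at each point.
  let s : Fin (2 * N * M) → ℝ := fun i => ((i : ℕ) - N * M : ℝ) / M
  let t : Fin (2 * N * M) → ℝ := fun i => ((i : ℕ) - N * M + 1 : ℝ) / M
  have hmem : ∀ i u, u ∈ Ioc (s i) (t i) ↔ (i : ℕ) = ⌈u * M⌉ - 1 + N * M := by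
    intro i u
    rw [mem_Ioc, div_lt_iff₀ hM0, le_div_iff₀ hM0]
    have h1 : ((i : ℕ) : ℤ) = ⌈u * M⌉ - 1 + N * M ↔ ⌈u * M⌉ = (i : ℕ) - N * M + 1 := by
      constructor <;> intro h <;> linarith
    rw [h1, Int.ceil_eq_iff]
    push_cast
    constructor <;> rintro ⟨h2, h3⟩ <;> constructor <;> linarith
  refine ⟨2 * N * M, s, t, fun i => g (t i), fun i => ?_, fun u hu => ?_, fun u hu => ?_⟩
  · exact div_le_div_of_nonneg_right (by linarith) hM0.le
  · have hk0 : 0 ≤ ⌈u * M⌉ - 1 + N * M := by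
      have : -(N * M : ℤ) < ⌈u * M⌉ := by
        rw [Int.lt_ceil]
        push_cast
        nlinarith [hu.1]
      linarith
    have hk1 : ⌈u * M⌉ - 1 + N * M < 2 * N * M := by
      have : ⌈u * M⌉ ≤ (N * M : ℤ) := by
        rw [Int.ceil_le]
        push_cast
        nlinarith [hu.2]
      linarith
    obtain ⟨k, hk⟩ := Int.eq_ofNat_of_zero_le hk0
    have hk2 : k < 2 * N * M := by
      rw [hk] at hk1
      exact_mod_cast hk1
    have hk3 : u ∈ Ioc (s ⟨k, hk2⟩) (t ⟨k, hk2⟩) := by rw [hmem, hk]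
    rw [Finset.sum_eq_single ⟨k, hk2⟩, indicator_of_mem hk3, ← dist_eq_norm]
    · refine (hgδ ?_).le
      refine lt_of_le_of_lt ?_ hMδ
      have h1 : t ⟨k, hk2⟩ = s ⟨k, hk2⟩ + 1 / M := by simp only [s, t]; ring
      rw [Real.dist_eq, abs_of_nonneg (sub_nonneg.2 hk3.2)]
      linarith [hk3.1]
    · intro i _ hi
      refine indicator_of_notMem (fun hcon => hi ?_) _
      rw [hmem] at hcon
      ext
      have := hcon.trans hk
      exact_mod_cast this
    · simp
  · refine Finset.sum_eq_zero fun i _ => indicator_of_notMem (fun hcon => hu ?_) _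
    have hi : ((i : ℕ) : ℝ) + 1 ≤ 2 * N * M := by exact_mod_cast i.2
    have h1 : -(N : ℝ) ≤ s i := by
      rw [le_div_iff₀ hM0]
      have : (0 : ℝ) ≤ (i : ℕ) := Nat.cast_nonneg _
      linarith
    have h2 : t i ≤ N := by
      rw [div_le_iff₀ hM0]
      linarith
    exact ⟨h1.trans_lt hcon.1, hcon.2.trans h2⟩

/-- Step functions are dense in `L¹ ∩ L²`. -/
theorem exists_step_approx {E : Type*} [NormedAddCommGroup E] [NormedSpace ℝ E] {f : ℝ → E}
    (hf1 : MemLp f 1 volume) (hf2 : MemLp f 2 volume) {ε : ℝ} (hε : 0 < ε) :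
    ∃ (n : ℕ) (s t : Fin n → ℝ) (A : Fin n → E), (∀ i, s i ≤ t i) ∧
      eLpNorm ((fun u => ∑ i, (Ioc (s i) (t i)).indicator (fun _ => A i) u) - f) 1 volume
        ≤ ENNReal.ofReal ε ∧
      eLpNorm ((fun u => ∑ i, (Ioc (s i) (t i)).indicator (fun _ => A i) u) - f) 2 volume
        ≤ ENNReal.ofReal ε := by
  have hε2 : ENNReal.ofReal (ε / 2) ≠ 0 := by simpa using hε
  -- `g₁` and `g₂` serve only to control `f` outside `(-N, N]`, one for each norm. Inside, a third
  -- function `g`, close to `f` in `L²`, handles both norms.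
  obtain ⟨g₁, hg₁, hfg₁, -, hm₁⟩ := hf1.exists_hasCompactSupport_eLpNorm_sub_le (by simp) hε2
  obtain ⟨g₂, hg₂, hfg₂, -, hm₂⟩ := hf2.exists_hasCompactSupport_eLpNorm_sub_le (by simp) hε2
  obtain ⟨R, hR⟩ := (hg₁.isCompact.union hg₂.isCompact).isBounded.subset_closedBall 0
  obtain ⟨N, hN⟩ := exists_nat_gt (max R 1)
  have hN1 : (1 : ℝ) < N := (le_max_right _ _).trans_lt hN
  have hzero : ∀ u ∉ Ioc (-N : ℝ) N, g₁ u = 0 ∧ g₂ u = 0 := by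
    intro u hu
    have h1 : u ∉ tsupport g₁ ∪ tsupport g₂ := by
      intro hcon
      have := hR hcon
      rw [mem_closedBall_zero_iff, Real.norm_eq_abs, abs_le] at this
      have := (le_max_left R 1).trans_lt hN
      exact hu ⟨by linarith, by linarith⟩
    rw [mem_union, not_or] at h1
    exact ⟨image_eq_zero_of_notMem_tsupport h1.1, image_eq_zero_of_notMem_tsupport h1.2⟩
  -- The length of `(-N, N]`. Passing from the uniform norm to `L²`, and from `L²` to `L¹`, costs a
  -- factor `c ^ (1 / 2) ≤ c` each time, whence the tolerances `ε / (4 * c)` and `ε / (4 * c ^ 2)`.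
  set c : ℝ := 2 * N with hc
  have hc1 : 1 ≤ c := by linarith
  obtain ⟨g, hg, hfg, hgc, hgm⟩ := hf2.exists_hasCompactSupport_eLpNorm_sub_le (by simp)
    (ε := ENNReal.ofReal (ε / (4 * c))) (by simp; positivity)
  obtain ⟨n, s, t, A, hst, hA, hA0⟩ := exists_step_uniform_approx
    (hg.uniformContinuous_of_continuous hgc) N (η := ε / (4 * c ^ 2)) (by positivity)
  refine ⟨n, s, t, A, hst, ?_⟩
  set φ : ℝ → E := fun u => ∑ i, (Ioc (s i) (t i)).indicator (fun _ => A i) u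
  set K : Set ℝ := Ioc (-N : ℝ) N
  have hK : MeasurableSet K := measurableSet_Ioc
  have hφm : AEStronglyMeasurable φ volume :=
    Finset.aestronglyMeasurable_fun_sum _ fun i _ =>
      aestronglyMeasurable_const.indicator measurableSet_Ioc
  have hvol : volume.restrict K univ = ENNReal.ofReal c := by
    rw [Measure.restrict_apply_univ, Real.volume_Ioc]
    congr 1
    ring
  have hpow : (ENNReal.ofReal c) ^ (1 / 2 : ℝ) ≤ ENNReal.ofReal c := by
    conv_rhs => rw [← ENNReal.rpow_one (ENNReal.ofReal c)]
    exact ENNReal.rpow_le_rpow_of_exponent_le (by simpa using hc1) (by norm_num)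
  have hK2 : eLpNorm (φ - f) 2 (volume.restrict K) ≤ ENNReal.ofReal (ε / (2 * c)) := by
    have h1 : eLpNorm (φ - g) 2 (volume.restrict K) ≤ ENNReal.ofReal (ε / (4 * c)) := by
      refine (eLpNorm_le_of_ae_bound (C := ε / (4 * c ^ 2)) ?_).trans ?_
      · filter_upwards [ae_restrict_mem hK] with u hu
        exact hA u hu
      · rw [hvol]
        have h2 : ENNReal.ofReal c ^ (2 : ℝ≥0∞).toReal⁻¹ ≤ ENNReal.ofReal c := by
          simpa using hpow
        refine (mul_le_mul_left h2 _).trans ?_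
        rw [← ENNReal.ofReal_mul (by linarith)]
        refine ENNReal.ofReal_le_ofReal (le_of_eq ?_)
        field_simp
    have h2 : eLpNorm (g - f) 2 (volume.restrict K) ≤ ENNReal.ofReal (ε / (4 * c)) := by
      rw [eLpNorm_sub_comm]
      exact (eLpNorm_mono_measure _ Measure.restrict_le_self).trans hfg
    calc eLpNorm (φ - f) 2 (volume.restrict K)
        = eLpNorm ((φ - g) + (g - f)) 2 (volume.restrict K) := by rw [sub_add_sub_cancel]
      _ ≤ _ := eLpNorm_add_le (hφm.sub hgm.1).restrict (hgm.1.sub hf2.1).restrict one_le_two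
      _ ≤ _ := add_le_add h1 h2
      _ = ENNReal.ofReal (ε / (2 * c)) := by
        rw [← ENNReal.ofReal_add (by positivity) (by positivity)]
        congr 1
        field_simp
        norm_num
  have hK1 : eLpNorm (φ - f) 1 (volume.restrict K) ≤ ENNReal.ofReal (ε / 2) := by
    refine (eLpNorm_le_eLpNorm_mul_rpow_measure_univ one_le_two (hφm.sub hf2.1).restrict).trans ?_
    rw [hvol]
    have h2 : ENNReal.ofReal c ^ (1 / (1 : ℝ≥0∞).toReal - 1 / (2 : ℝ≥0∞).toReal) ≤
        ENNReal.ofReal c := by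
      convert hpow using 2
      norm_num
    refine (mul_le_mul' hK2 h2).trans ?_
    rw [← ENNReal.ofReal_mul (by positivity)]
    refine ENNReal.ofReal_le_ofReal (le_of_eq ?_)
    field_simp
  have key : ∀ (p : ℝ≥0∞) (g' : ℝ → E), 1 ≤ p → (∀ u ∉ K, g' u = 0) →
      eLpNorm (f - g') p volume ≤ ENNReal.ofReal (ε / 2) →
      eLpNorm (φ - f) p (volume.restrict K) ≤ ENNReal.ofReal (ε / 2) →
      eLpNorm (φ - f) p volume ≤ ENNReal.ofReal ε := by
    intro p g' hp hg' h1 h2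
    have h3 : eLpNorm (Kᶜ.indicator (φ - f)) p volume ≤ ENNReal.ofReal (ε / 2) := by
      refine (eLpNorm_mono fun u => ?_).trans h1
      by_cases hu : u ∈ K
      · simp [hu]
      · have : φ u = 0 := hA0 u hu
        simp [hu, this, hg' u hu]
    rw [← eLpNorm_indicator_eq_eLpNorm_restrict hK] at h2
    calc eLpNorm (φ - f) p volume
        = eLpNorm (K.indicator (φ - f) + Kᶜ.indicator (φ - f)) p volume := by
          rw [indicator_self_add_compl]
      _ ≤ _ := eLpNorm_add_le ((hφm.sub hf2.1).indicator hK)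
          ((hφm.sub hf2.1).indicator hK.compl) hp
      _ ≤ _ := add_le_add h2 h3
      _ = ENNReal.ofReal ε := by
        rw [← ENNReal.ofReal_add (by positivity) (by positivity), add_halves]
  refine ⟨key 1 g₁ le_rfl (fun u hu => (hzero u hu).1) hfg₁ hK1,
    key 2 g₂ one_le_two (fun u hu => (hzero u hu).2) hfg₂ (hK2.trans ?_)⟩
  refine ENNReal.ofReal_le_ofReal ?_
  exact div_le_div_of_nonneg_left hε.le (by norm_num) (by linarith)

/-- Every `f ∈ L¹ ∩ L²` is approximated by step functions. -/
theorem StepFun.exists_approximates {d m : ℕ} {f : ℝ → Matrix (Fin d) (Fin m) ℝ}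
    (hf1 : Integrable f volume) (hf2 : MemLp f 2 volume) :
    ∃ φ : ℕ → StepFun d m, StepFun.Approximates φ f := by
  have h : ∀ k : ℕ, ∃ φ : StepFun d m,
      eLpNorm (φ.toFun - f) 1 volume ≤ ENNReal.ofReal (1 / (k + 1)) ∧
      eLpNorm (φ.toFun - f) 2 volume ≤ ENNReal.ofReal (1 / (k + 1)) := by
    intro k
    obtain ⟨n, s, t, A, hst, h1, h2⟩ := exists_step_approx (memLp_one_iff_integrable.2 hf1) hf2
      (ε := 1 / (k + 1)) (by positivity)
    exact ⟨⟨n, s, t, hst, A⟩, h1, h2⟩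
  choose φ h1 h2 using h
  have hlim : Tendsto (fun k : ℕ => ENNReal.ofReal (1 / (k + 1))) atTop (𝓝 0) := by
    simpa using ENNReal.tendsto_ofReal (tendsto_one_div_add_atTop_nhds_zero_nat (𝕜 := ℝ))
  exact ⟨φ, tendsto_of_tendsto_of_tendsto_of_le_of_le tendsto_const_nhds hlim
      (fun _ => zero_le) h1,
    tendsto_of_tendsto_of_tendsto_of_le_of_le tendsto_const_nhds hlim (fun _ => zero_le) h2⟩

/-! ### The centred integral as an operator on `L²` -/

/-- The class in `L²` of `1_{(s, t]}`. -/
noncomputable def IocLp (s t : ℝ) : Lp ℝ 2 (volume : Measure ℝ) :=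
  indicatorConstLp 2 (measurableSet_Ioc (a := s) (b := t)) (by simp) 1

/-- The class in `L²` of `signedIndicator t`. -/
noncomputable def signedIndicatorLp (t : ℝ) : Lp ℝ 2 (volume : Measure ℝ) :=
  (memLp_signedIndicator t 2).toLp _

theorem signedIndicatorLp_sub {s t : ℝ} (hst : s ≤ t) :
    signedIndicatorLp t - signedIndicatorLp s = IocLp s t := by
  rw [signedIndicatorLp, signedIndicatorLp, ← MemLp.toLp_sub]
  simp_rw [signedIndicator_sub hst]
  rfl

theorem toLp_step_eq_sum {n : ℕ} (s t : Fin n → ℝ) (A : Fin n → ℝ)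
    (h : MemLp (fun u => ∑ i, (Ioc (s i) (t i)).indicator (fun _ => A i) u) 2 volume) :
    h.toLp _ = ∑ i, A i • IocLp (s i) (t i) := by
  refine Lp.ext ?_
  have h1 : ∀ i, A i • IocLp (s i) (t i) =ᵐ[volume]
      (Ioc (s i) (t i)).indicator (fun _ => A i) := by
    intro i
    filter_upwards [Lp.coeFn_smul (A i) (IocLp (s i) (t i)),
      indicatorConstLp_coeFn (p := 2) (hs := measurableSet_Ioc (a := s i) (b := t i))
        (hμs := by simp) (c := (1 : ℝ)) (μ := volume)] with u hu1 hu2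
    rw [hu1, Pi.smul_apply, IocLp, hu2]
    simp [indicator_apply]
  filter_upwards [h.coeFn_toLp, Lp.coeFn_finsetSum Finset.univ (fun i => A i • IocLp (s i) (t i)),
    ae_all_iff.2 h1] with u hu1 hu2 hu3
  rw [hu1, hu2, Finset.sum_apply]
  exact Finset.sum_congr rfl fun i _ => (hu3 i).symm

/-- Step functions are combinations of differences of signed indicators. A continuous, compactly
supported approximant comes first, because the step approximation also requires integrability. -/
theorem denseRange_signedIndicatorLp :
    DenseRange (Finsupp.linearCombination ℝ signedIndicatorLp) := by
  intro x
  rw [Metric.mem_closure_iff]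
  intro ε hε
  obtain ⟨g, hg, hxg, hgc, hgm⟩ := (Lp.memLp x).exists_hasCompactSupport_eLpNorm_sub_le (by simp)
    (ε := ENNReal.ofReal (ε / 4)) (by simpa using hε)
  obtain ⟨n, s, t, A, hst, -, h2⟩ := exists_step_approx (ε := ε / 4)
    (memLp_one_iff_integrable.2 (hgc.integrable_of_hasCompactSupport hg)) hgm (by positivity)
  have hm : MemLp (fun u => ∑ i, (Ioc (s i) (t i)).indicator (fun _ => A i) u) 2 volume :=
    memLp_finsetSum _ fun i _ => memLp_indicator_const 2 measurableSet_Ioc _ (Or.inr (by simp))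
  refine ⟨hm.toLp _, ⟨∑ i, A i • (Finsupp.single (t i) 1 - Finsupp.single (s i) 1), ?_⟩, ?_⟩
  · simp [toLp_step_eq_sum, signedIndicatorLp_sub (hst _)]
  · have h3 : edist x (hm.toLp _) ≤ ENNReal.ofReal (ε / 4) + ENNReal.ofReal (ε / 4) := by
      rw [Lp.edist_def]
      refine le_trans (le_of_eq (eLpNorm_congr_ae (g := (⇑x - g) + (g - fun u => ∑ i,
        (Ioc (s i) (t i)).indicator (fun _ => A i) u)) ?_)) ?_
      · filter_upwards [hm.coeFn_toLp] with u hu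
        simp [hu]
      · refine (eLpNorm_add_le ((Lp.memLp x).1.sub hgm.1) (hgm.1.sub hm.1) one_le_two).trans ?_
        rw [eLpNorm_sub_comm g]
        exact add_le_add hxg h2
    rw [← ENNReal.ofReal_add (by positivity) (by positivity), edist_dist,
      ENNReal.ofReal_le_ofReal_iff (by positivity)] at h3
    linarith

namespace HasLevyMoments

variable {Ω : Type*} [MeasurableSpace Ω] {P : Measure Ω} [IsProbabilityMeasure P]
  {Z : ℝ → Ω → ℝ} {μ v : ℝ}

theorem memLp_centred (h : HasLevyMoments Z P μ v) (t : ℝ) :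
    MemLp (fun ω => Z t ω - t * μ) 2 P :=
  (h.memLp t).sub (memLp_const _)

/-- The isometry (up to the factor `v`) of `L²(ℝ)` into `L²(P)` that extends the elementary
integral with respect to the centred process. -/
theorem exists_centredIntegral (h : HasLevyMoments Z P μ v) (hv : 0 ≤ v) :
    ∃ Φ : Lp ℝ 2 (volume : Measure ℝ) →L[ℝ] Lp ℝ 2 P, ∀ s t, s ≤ t →
      Φ (IocLp s t) =ᵐ[P] fun ω => Z t ω - Z s ω - (t - s) * μ := by
  let w : ℝ → Lp ℝ 2 P := fun t => (h.memLp_centred t).toLp _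
  have hw : ∀ s t, inner ℝ (w s) (w t) =
      v * inner ℝ (signedIndicatorLp s) (signedIndicatorLp t) := by
    intro s t
    rw [L2.inner_def, L2.inner_def]
    have h1 := h.covariance_eq s t
    rw [covariance, h.integral_eq, h.integral_eq] at h1
    calc _ = ∫ ω, (Z s ω - s * μ) * (Z t ω - t * μ) ∂P := by
          refine integral_congr_ae ?_
          filter_upwards [(h.memLp_centred s).coeFn_toLp, (h.memLp_centred t).coeFn_toLp]
            with ω h2 h3
          simp only [w, h2, h3]
          simp [mul_comm]
      _ = v * ∫ u, signedIndicator s u * signedIndicator t u := h1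
      _ = _ := by
          congr 1
          refine integral_congr_ae ?_
          filter_upwards [(memLp_signedIndicator s 2).coeFn_toLp,
            (memLp_signedIndicator t 2).coeFn_toLp] with u h2 h3
          simp only [signedIndicatorLp, h2, h3]
          simp [mul_comm]
  let e := Finsupp.linearCombination ℝ signedIndicatorLp
  let f := Finsupp.linearCombination ℝ w
  -- Proportional Gram kernels give `‖f x‖ ^ 2 = v * ‖e x‖ ^ 2` on all finite combinations. Thus `f`
  -- factors through `e` with bound `√v`, and extends by density of the range of `e`.
  have hinner : ∀ x, inner ℝ (f x) (f x) = v * inner ℝ (e x) (e x) := by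
    intro x
    simp only [f, e, Finsupp.linearCombination_apply, Finsupp.sum, sum_inner, inner_sum,
      inner_smul_left, inner_smul_right, hw, Finset.mul_sum]
    refine Finset.sum_congr rfl fun i _ => Finset.sum_congr rfl fun j _ => ?_
    ring
  have hnorm : ∃ C, ∀ x, ‖f x‖ ≤ C * ‖e x‖ := by
    refine ⟨√v, fun x => ?_⟩
    refine le_of_sq_le_sq ?_ (by positivity)
    rw [mul_pow, Real.sq_sqrt hv, ← real_inner_self_eq_norm_sq, ← real_inner_self_eq_norm_sq,
      hinner]
  refine ⟨f.extendOfNorm e, fun s t hst => ?_⟩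
  have h1 : IocLp s t = e (Finsupp.single t 1 - Finsupp.single s 1) := by
    simp [e, signedIndicatorLp_sub hst]
  have h2 : f (Finsupp.single t 1 - Finsupp.single s 1) = w t - w s := by simp [f]
  rw [h1, LinearMap.extendOfNorm_eq denseRange_signedIndicatorLp hnorm, h2]
  filter_upwards [Lp.coeFn_sub (w t) (w s), (h.memLp_centred s).coeFn_toLp,
    (h.memLp_centred t).coeFn_toLp] with ω h3 h4 h5
  rw [h3, Pi.sub_apply, h4, h5]
  ring

end HasLevyMoments

/-! ### Scalar integrals with drift -/

section ScalarIntegral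

variable {Ω : Type*} [MeasurableSpace Ω] {P : Measure Ω}
  {Z : ℝ → Ω → ℝ} {μ v : ℝ}

/-- The integral with drift of a scalar integrand, as the sum of a centred part and a drift. -/
noncomputable def scalarIntegral (Φ : Lp ℝ 2 (volume : Measure ℝ) →L[ℝ] Lp ℝ 2 P) (μ : ℝ)
    (f : ℝ → ℝ) (hf : MemLp f 2 volume) (ω : Ω) : ℝ :=
  Φ (hf.toLp f) ω + μ * ∫ u, f u

theorem memLp_scalarIntegral [IsProbabilityMeasure P]
    (Φ : Lp ℝ 2 (volume : Measure ℝ) →L[ℝ] Lp ℝ 2 P) (μ : ℝ)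
    {f : ℝ → ℝ} (hf : MemLp f 2 volume) : MemLp (scalarIntegral Φ μ f hf) 2 P := by
  have h := (Lp.memLp (Φ (hf.toLp f))).add (memLp_const (μ * ∫ u, f u))
  exact h

theorem memLp_step {n : ℕ} (s t a : Fin n → ℝ) (p : ℝ≥0∞) :
    MemLp (fun u => ∑ i, (Ioc (s i) (t i)).indicator (fun _ => a i) u) p volume :=
  memLp_finsetSum _ fun i _ => memLp_indicator_const p measurableSet_Ioc _ (Or.inr (by simp))

/-- The drift `μ ∫ φ` restores exactly the compensators `(t - s) * μ` subtracted in `hΦ`. -/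
theorem scalarIntegral_step {Φ : Lp ℝ 2 (volume : Measure ℝ) →L[ℝ] Lp ℝ 2 P}
    (hΦ : ∀ s t, s ≤ t → Φ (IocLp s t) =ᵐ[P] fun ω => Z t ω - Z s ω - (t - s) * μ)
    {n : ℕ} {s t : Fin n → ℝ} (hst : ∀ i, s i ≤ t i) (a : Fin n → ℝ) :
    scalarIntegral Φ μ _ (memLp_step s t a 2) =ᵐ[P]
      fun ω => ∑ i, a i * (Z (t i) ω - Z (s i) ω) := by
  have h1 : Φ ((memLp_step s t a 2).toLp _) = ∑ i, a i • Φ (IocLp (s i) (t i)) := by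
    rw [toLp_step_eq_sum, map_sum]
    simp
  have h2 : ∫ u, ∑ i, (Ioc (s i) (t i)).indicator (fun _ => a i) u =
      ∑ i, a i * (t i - s i) := by
    rw [integral_finsetSum]
    · refine Finset.sum_congr rfl fun i _ => ?_
      rw [integral_indicator_const _ measurableSet_Ioc, Real.volume_real_Ioc_of_le (hst i),
        smul_eq_mul, mul_comm]
    · exact fun i _ => memLp_one_iff_integrable.1
        (memLp_indicator_const 1 measurableSet_Ioc _ (Or.inr (by simp)))
  have h3 : ∀ i, (a i • Φ (IocLp (s i) (t i)) : Lp ℝ 2 P) =ᵐ[P]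
      fun ω => a i * (Z (t i) ω - Z (s i) ω - (t i - s i) * μ) := by
    intro i
    filter_upwards [Lp.coeFn_smul (a i) (Φ (IocLp (s i) (t i))), hΦ _ _ (hst i)] with ω h4 h5
    rw [h4, Pi.smul_apply, h5, smul_eq_mul]
  filter_upwards [Lp.coeFn_finsetSum Finset.univ fun i => a i • Φ (IocLp (s i) (t i)),
    ae_all_iff.2 h3] with ω h4 h5
  rw [scalarIntegral, h1, h2, h4, Finset.sum_apply, Finset.mul_sum, ← Finset.sum_add_distrib]
  refine Finset.sum_congr rfl fun i _ => ?_
  rw [h5]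
  ring

/-- The `L²` norm controls the part passing through `Φ` and the `L¹` norm the drift, matching the
two modes of convergence in `StepFun.Approximates`. -/
theorem eLpNorm_scalarIntegral_sub_le [IsProbabilityMeasure P]
    (Φ : Lp ℝ 2 (volume : Measure ℝ) →L[ℝ] Lp ℝ 2 P) (μ : ℝ)
    {f g : ℝ → ℝ} (hf : MemLp f 2 volume) (hg : MemLp g 2 volume)
    (hf1 : Integrable f volume) (hg1 : Integrable g volume) :
    eLpNorm (scalarIntegral Φ μ f hf - scalarIntegral Φ μ g hg) 2 P ≤
      ‖Φ‖ₑ * eLpNorm (f - g) 2 volume + ‖μ‖ₑ * eLpNorm (f - g) 1 volume := by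
  have h1 : scalarIntegral Φ μ f hf - scalarIntegral Φ μ g hg =ᵐ[P]
      (Φ ((hf.sub hg).toLp _) : Ω → ℝ) + fun _ => μ * ∫ u, (f - g) u := by
    rw [MemLp.toLp_sub hf hg, map_sub]
    filter_upwards [Lp.coeFn_sub (Φ (hf.toLp f)) (Φ (hg.toLp g))] with ω h2
    simp only [scalarIntegral, Pi.sub_apply, Pi.add_apply, h2, integral_sub hf1 hg1]
    ring
  rw [eLpNorm_congr_ae h1]
  refine (eLpNorm_add_le (Lp.memLp _).1 aestronglyMeasurable_const one_le_two).trans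
    (add_le_add ?_ ?_)
  · rw [← Lp.enorm_def]
    refine (Φ.le_opENorm _).trans (le_of_eq ?_)
    rw [Lp.enorm_toLp]
  · rw [eLpNorm_const _ (by simp) (IsProbabilityMeasure.ne_zero P), measure_univ,
      ENNReal.one_rpow, mul_one, enorm_mul, eLpNorm_one_eq_lintegral_enorm]
    gcongr
    exact enorm_integral_le_lintegral_enorm _

end ScalarIntegral

/-! ### Matrix integrands -/

/-- The `(r, j)` entry of a matrix as a continuous linear functional. -/
noncomputable def matrixEntry {d m : ℕ} (r : Fin d) (j : Fin m) :
    Matrix (Fin d) (Fin m) ℝ →L[ℝ] ℝ :=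
  LinearMap.toContinuousLinearMap (Matrix.entryLinearMap ℝ ℝ r j)

theorem MeasureTheory.MemLp.matrixEntry {α : Type*} [MeasurableSpace α] {ν : Measure α} {d m : ℕ}
    {f : α → Matrix (Fin d) (Fin m) ℝ} {p : ℝ≥0∞} (hf : MemLp f p ν) (r : Fin d) (j : Fin m) :
    MemLp (fun u => f u r j) p ν :=
  (_root_.matrixEntry r j).comp_memLp' hf

theorem eLpNorm_matrixEntry_sub_le {d m : ℕ} (f g : ℝ → Matrix (Fin d) (Fin m) ℝ) (p : ℝ≥0∞)
    (r : Fin d) (j : Fin m) :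
    eLpNorm ((fun u => f u r j) - fun u => g u r j) p volume ≤
      ‖matrixEntry (d := d) (m := m) r j‖ₑ * eLpNorm (f - g) p volume := by
  refine (eLpNorm_le_nnreal_smul_eLpNorm_of_ae_le_mul
    (c := ‖matrixEntry (d := d) (m := m) r j‖₊) (.of_forall fun u => ?_) p).trans le_rfl
  exact (matrixEntry r j).le_opNNNorm (f u - g u)

theorem eLpNorm_euclidean_le_sum {α : Type*} [MeasurableSpace α] {ν : Measure α} {d : ℕ}
    {I : α → EuclideanSpace ℝ (Fin d)} (hI : AEStronglyMeasurable I ν) {p : ℝ≥0∞} (hp : 1 ≤ p) :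
    eLpNorm I p ν ≤ ∑ r, eLpNorm (fun ω => I ω r) p ν := by
  have h1 : I = ∑ r, fun ω => I ω r • EuclideanSpace.single r (1 : ℝ) := by
    ext ω k
    simp [Finset.sum_apply, Pi.single_apply]
  have h2 : ∀ r, AEStronglyMeasurable
      (fun ω => I ω r • (EuclideanSpace.single r (1 : ℝ) : EuclideanSpace ℝ (Fin d))) ν := by
    intro r
    have hc : Continuous fun x : EuclideanSpace ℝ (Fin d) =>
        x r • (EuclideanSpace.single r (1 : ℝ) : EuclideanSpace ℝ (Fin d)) := by
      fun_prop
    exact hc.comp_aestronglyMeasurable hI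
  conv_lhs => rw [h1]
  refine (eLpNorm_sum_le (fun r _ => h2 r) hp).trans (Finset.sum_le_sum fun r _ => ?_)
  exact eLpNorm_mono fun ω => by simp [norm_smul]

/-- A random vector whose components are given by the integrals of the matrix entries is a version
of the stochastic integral. -/
theorem isLevyIntegral_of_ae_eq {Ω : Type*} [MeasurableSpace Ω] {P : Measure Ω}
    [IsProbabilityMeasure P] {d m : ℕ} {L : ℝ → Ω → EuclideanSpace ℝ (Fin m)} {μ v : Fin m → ℝ}
    (hL : ∀ j, HasLevyMoments (fun t ω => L t ω j) P (μ j) (v j))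
    {Φ : Fin m → Lp ℝ 2 (volume : Measure ℝ) →L[ℝ] Lp ℝ 2 P}
    (hΦ : ∀ j s t, s ≤ t →
      Φ j (IocLp s t) =ᵐ[P] fun ω => L t ω j - L s ω j - (t - s) * μ j)
    {f : ℝ → Matrix (Fin d) (Fin m) ℝ} (hf1 : Integrable f volume) (hf2 : MemLp f 2 volume)
    {I : Ω → EuclideanSpace ℝ (Fin d)}
    (hI : ∀ r, (fun ω => I ω r) =ᵐ[P]
      fun ω => ∑ j, scalarIntegral (Φ j) (μ j) _ (hf2.matrixEntry r j) ω) :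
    IsLevyIntegral L P f I := by
  have hIm : MemLp I 2 P := by
    refine MemLp.of_eval_piLp fun r => (memLp_congr_ae (hI r)).2 ?_
    exact memLp_finsetSum _ fun j _ => memLp_scalarIntegral _ _ _
  have hLm : ∀ t, AEStronglyMeasurable (L t) P := fun t =>
    (MemLp.of_eval_piLp (p := 2) fun j => (hL j).memLp t).1
  refine ⟨hf1, hf2, hIm, StepFun.exists_approximates hf1 hf2, fun φ hφ => ?_⟩
  have hφm : ∀ n, AEStronglyMeasurable ((φ n).integral L) P := by
    intro n
    unfold StepFun.integral
    refine Finset.aestronglyMeasurable_fun_sum _ fun i _ => ?_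
    have hc : Continuous (fun x : EuclideanSpace ℝ (Fin m) =>
        (WithLp.toLp 2 ((φ n).A i *ᵥ x.ofLp) : EuclideanSpace ℝ (Fin d))) := by fun_prop
    exact hc.comp_aestronglyMeasurable ((hLm _).sub (hLm _))
  have hentry : ∀ n r j, (fun u => (φ n).toFun u r j) =
      fun u => ∑ i, (Ioc ((φ n).s i) ((φ n).t i)).indicator (fun _ => (φ n).A i r j) u := by
    intro n r j
    ext u
    simp only [StepFun.toFun, Matrix.sum_apply, indicator_apply]
    refine Finset.sum_congr rfl fun i _ => ?_
    split_ifs <;> rfl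
  have hstep : ∀ n r j, MemLp (fun u => (φ n).toFun u r j) 2 volume ∧
      Integrable (fun u => (φ n).toFun u r j) volume := by
    intro n r j
    rw [hentry]
    exact ⟨memLp_step _ _ _ 2, memLp_one_iff_integrable.1 (memLp_step _ _ _ 1)⟩
  have hcomp : ∀ n (r : Fin d), (fun ω => (φ n).integral L ω r) =ᵐ[P]
      fun ω => ∑ j, scalarIntegral (Φ j) (μ j) _ (hstep n r j).1 ω := by
    intro n r
    have h1 : ∀ j, scalarIntegral (Φ j) (μ j) _ (hstep n r j).1 =ᵐ[P] fun ω => ∑ i,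
        (φ n).A i r j * (L ((φ n).t i) ω j - L ((φ n).s i) ω j) := by
      intro j
      have h2 := scalarIntegral_step (hΦ j) (φ n).le fun i => (φ n).A i r j
      convert h2 using 2
      exact hentry n r j
    filter_upwards [ae_all_iff.2 h1] with ω hω
    simp_rw [hω]
    rw [Finset.sum_comm]
    simp [StepFun.integral, Matrix.mulVec, dotProduct]
  have hbound : ∀ n, eLpNorm ((φ n).integral L - I) 2 P ≤ ∑ r : Fin d, ∑ j : Fin m,
      (‖Φ j‖ₑ * (‖matrixEntry r j‖ₑ * eLpNorm ((φ n).toFun - f) 2 volume) +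
        ‖μ j‖ₑ * (‖matrixEntry r j‖ₑ * eLpNorm ((φ n).toFun - f) 1 volume)) := by
    intro n
    refine (eLpNorm_euclidean_le_sum ((hφm n).sub hIm.1) one_le_two).trans
      (Finset.sum_le_sum fun r _ => ?_)
    have h1 : (fun ω => ((φ n).integral L - I) ω r) =ᵐ[P] ∑ j,
        (scalarIntegral (Φ j) (μ j) _ (hstep n r j).1 -
          scalarIntegral (Φ j) (μ j) _ (hf2.matrixEntry r j)) := by
      filter_upwards [hcomp n r, hI r] with ω h2 h3
      simp only [Pi.sub_apply, PiLp.sub_apply, h2, h3, Finset.sum_apply, Finset.sum_sub_distrib]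
    rw [eLpNorm_congr_ae h1]
    refine (eLpNorm_sum_le (fun j _ => ((memLp_scalarIntegral _ _ _).sub
      (memLp_scalarIntegral _ _ _)).1) one_le_two).trans (Finset.sum_le_sum fun j _ => ?_)
    refine (eLpNorm_scalarIntegral_sub_le (Φ j) (μ j) _ _ (hstep n r j).2
      ((matrixEntry r j).integrable_comp hf1)).trans ?_
    gcongr <;> exact eLpNorm_matrixEntry_sub_le _ _ _ _ _
  refine tendsto_of_tendsto_of_tendsto_of_le_of_le tendsto_const_nhds ?_
    (fun _ => zero_le) hbound
  have hlim : ∀ (c c' : ℝ≥0∞) (x : ℕ → ℝ≥0∞), c ≠ ∞ → c' ≠ ∞ → Tendsto x atTop (𝓝 0) →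
      Tendsto (fun n => c * (c' * x n)) atTop (𝓝 0) := by
    intro c c' x hc hc' hx
    simpa using ENNReal.Tendsto.const_mul (ENNReal.Tendsto.const_mul hx (Or.inr hc')) (Or.inr hc)
  have h0 : (0 : ℝ≥0∞) = ∑ r : Fin d, ∑ j : Fin m, (0 + 0) := by simp
  rw [h0]
  refine tendsto_finsetSum _ fun r _ => tendsto_finsetSum _ fun j _ => Tendsto.add ?_ ?_
  · exact hlim _ _ _ enorm_ne_top enorm_ne_top hφ.2
  · exact hlim _ _ _ enorm_ne_top enorm_ne_top hφ.1

/-! ### Measurable versions and Fubini's theorem for operators on `L²` -/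

section MeasurableVersion

variable {Ω : Type*} [MeasurableSpace Ω] {P : Measure Ω} [IsProbabilityMeasure P]
  {α : Type*} [MeasurableSpace α]

/-- The image of a measurable family in `L²` under a continuous linear operator has a jointly
measurable version. -/
theorem exists_stronglyMeasurable_version (Φ : Lp ℝ 2 (volume : Measure ℝ) →L[ℝ] Lp ℝ 2 P)
    {F : α → ℝ → ℝ} (hF : StronglyMeasurable (Function.uncurry F))
    (hF2 : ∀ s, MemLp (F s) 2 volume) :
    ∃ J : α → Ω → ℝ, StronglyMeasurable (Function.uncurry J) ∧
      ∀ s, J s =ᵐ[P] Φ ((hF2 s).toLp (F s)) := by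
  classical
  have : Fact ((2 : ℝ≥0∞) ≠ ∞) := ⟨by simp⟩
  -- Choosing the first `x k` within `2⁻ⁿ` of `F s` is measurable in `s`. The resulting
  -- approximations take countably many values in `L²`, so they are jointly measurable after
  -- applying `Φ`.
  obtain ⟨x, hx⟩ := TopologicalSpace.exists_dense_seq (Lp ℝ 2 (volume : Measure ℝ))
  have hex : ∀ (n : ℕ) s, ∃ k, eLpNorm (F s - ⇑(x k)) 2 volume < (1 / 2) ^ n := by
    intro n s
    obtain ⟨k, hk⟩ := hx.exists_dist_lt ((hF2 s).toLp (F s)) (ε := (1 / 2) ^ n) (by positivity)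
    refine ⟨k, ?_⟩
    have h1 : edist ((hF2 s).toLp (F s)) (x k) < ENNReal.ofReal ((1 / 2) ^ n) := by
      rw [edist_dist]
      exact (ENNReal.ofReal_lt_ofReal_iff (by positivity)).2 hk
    rw [Lp.edist_def, ENNReal.ofReal_pow (by norm_num),
      ENNReal.ofReal_div_of_pos (by norm_num)] at h1
    refine lt_of_eq_of_lt (eLpNorm_congr_ae ?_) (h1.trans_eq (by norm_num))
    filter_upwards [(hF2 s).coeFn_toLp] with u hu
    simp [hu]
  have hmeas : ∀ n k, MeasurableSet {s | eLpNorm (F s - ⇑(x k)) 2 volume < (1 / 2) ^ n} := by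
    intro n k
    refine measurableSet_lt ?_ measurable_const
    simp_rw [eLpNorm_eq_lintegral_rpow_enorm_toReal (p := 2) (by simp) (by simp)]
    refine Measurable.pow_const ?_ _
    refine Measurable.lintegral_prod_right'
      (f := fun q : α × ℝ => ‖(F q.1 - x k) q.2‖ₑ ^ (2 : ℝ≥0∞).toReal) ?_
    refine Measurable.pow_const (Measurable.enorm ?_) _
    exact hF.measurable.sub ((Lp.stronglyMeasurable (x k)).measurable.comp measurable_snd)
  let k : ℕ → α → ℕ := fun n s => Nat.find (hex n s)
  have hk : ∀ n, Measurable (k n) := fun n => measurable_find (hex n) (hmeas n)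
  let J : ℕ → α → Ω → ℝ := fun n s => Φ (x (k n s))
  have hJ : ∀ n, StronglyMeasurable (Function.uncurry (J n)) := by
    intro n
    have h1 : Measurable fun q : ℕ × Ω => Φ (x q.1) q.2 :=
      measurable_from_prod_countable_right fun i => (Lp.stronglyMeasurable (Φ (x i))).measurable
    exact (h1.comp (((hk n).comp measurable_fst).prodMk measurable_snd)).stronglyMeasurable
  have hJF : ∀ n s, eLpNorm (J n s - ⇑(Φ ((hF2 s).toLp (F s)))) 2 P ≤ ‖Φ‖ₑ * (1 / 2) ^ n := by
    intro n s
    rw [← Lp.edist_def, edist_comm, edist_eq_enorm_sub, ← map_sub]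
    refine (Φ.le_opENorm _).trans ?_
    gcongr
    rw [← edist_eq_enorm_sub, Lp.edist_def]
    refine (le_of_eq (eLpNorm_congr_ae ?_)).trans (Nat.find_spec (hex n s)).le
    filter_upwards [(hF2 s).coeFn_toLp] with u hu
    simp [hu, k]
  have hJm : ∀ n s, AEStronglyMeasurable (J n s) P := fun n s => (Lp.memLp _).1
  -- Summable errors give almost sure convergence for each `s`. The `+ 1` provides strict inequality
  -- even when `Φ = 0`.
  have hsum : ∑' n : ℕ, (2 * ‖Φ‖ₑ + 1) * (1 / 2 : ℝ≥0∞) ^ n ≠ ∞ := by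
    rw [ENNReal.tsum_mul_left, ENNReal.tsum_geometric]
    refine ENNReal.mul_ne_top (ENNReal.add_ne_top.2
      ⟨ENNReal.mul_ne_top (by simp) enorm_ne_top, by simp⟩) ?_
    simp
  have hconv : ∀ s, ∀ᵐ ω ∂P, ∃ l, Tendsto (fun n => J n s ω) atTop (𝓝 l) := by
    intro s
    refine Lp.ae_tendsto_of_cauchy_eLpNorm (p := 2) (fun n => hJm n s) one_le_two hsum ?_
    intro N n m hn hm
    have hpow : ∀ i, N ≤ i → (1 / 2 : ℝ≥0∞) ^ i ≤ (1 / 2) ^ N := fun i hi =>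
      pow_le_pow_of_le_one zero_le (by simp) hi
    calc eLpNorm (J n s - J m s) 2 P
        = eLpNorm ((J n s - ⇑(Φ ((hF2 s).toLp (F s)))) + (⇑(Φ ((hF2 s).toLp (F s))) - J m s)) 2 P := by
          rw [sub_add_sub_cancel]
      _ ≤ eLpNorm (J n s - ⇑(Φ ((hF2 s).toLp (F s)))) 2 P +
          eLpNorm (⇑(Φ ((hF2 s).toLp (F s))) - J m s) 2 P :=
        eLpNorm_add_le ((hJm n s).sub (Lp.memLp _).1) ((Lp.memLp _).1.sub (hJm m s)) one_le_two
      _ ≤ ‖Φ‖ₑ * (1 / 2) ^ N + ‖Φ‖ₑ * (1 / 2) ^ N := by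
        refine add_le_add ((hJF n s).trans ?_) ?_
        · exact mul_le_mul' le_rfl (hpow n hn)
        · rw [eLpNorm_sub_comm]
          exact (hJF m s).trans (mul_le_mul' le_rfl (hpow m hm))
      _ = 2 * ‖Φ‖ₑ * (1 / 2) ^ N := by ring
      _ < (2 * ‖Φ‖ₑ + 1) * (1 / 2) ^ N := by
        refine ENNReal.mul_lt_mul_left (by simp) (ENNReal.pow_ne_top (by simp)) ?_
        exact ENNReal.lt_add_right (ENNReal.mul_ne_top (by simp) enorm_ne_top) one_ne_zero
  -- `limUnder` takes a default value where there is no limit; for each `s` this affects only a null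
  -- set of `ω`.
  have hlim : StronglyMeasurable fun q => limUnder atTop fun n => Function.uncurry (J n) q :=
    StronglyMeasurable.limUnder hJ
  refine ⟨fun s ω => limUnder atTop fun n => J n s ω, hlim, fun s => ?_⟩
  have h1 : TendstoInMeasure P (fun n => J n s) atTop
      (fun ω => limUnder atTop fun n => J n s ω) := by
    refine tendstoInMeasure_of_tendsto_ae (fun n => hJm n s) ?_
    filter_upwards [hconv s] with ω hω
    exact tendsto_nhds_limUnder hω
  refine tendstoInMeasure_ae_unique h1
    (tendstoInMeasure_of_tendsto_eLpNorm two_ne_zero (fun n => hJm n s) (Lp.memLp _).1 ?_)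
  refine tendsto_of_tendsto_of_tendsto_of_le_of_le tendsto_const_nhds ?_
    (fun _ => zero_le) fun n => hJF n s
  have h2 : Tendsto (fun n : ℕ => (1 / 2 : ℝ≥0∞) ^ n) atTop (𝓝 0) :=
    ENNReal.tendsto_pow_atTop_nhds_zero_of_lt_one (by simp)
  simpa using ENNReal.Tendsto.const_mul h2 (Or.inr enorm_ne_top)

theorem integral_sq_eq_norm_sq {β : Type*} [MeasurableSpace β] {ν : Measure β} {f : β → ℝ}
    {g : Lp ℝ 2 ν} (hfg : f =ᵐ[ν] g) : ∫ x, f x ^ 2 ∂ν = ‖g‖ ^ 2 := by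
  rw [← real_inner_self_eq_norm_sq, L2.inner_def]
  refine integral_congr_ae ?_
  filter_upwards [hfg] with x hx
  rw [hx, real_inner_self_eq_norm_sq, Real.norm_eq_abs, sq_abs]

variable {ν : Measure α} [IsFiniteMeasure ν]

/-- `E|J s| ≤ 1 + E|J s|² ≤ 1 + ‖Φ‖² ‖F s‖²`, and the right side is integrable for the finite
measure `ν`. -/
theorem integrable_uncurry_version (Φ : Lp ℝ 2 (volume : Measure ℝ) →L[ℝ] Lp ℝ 2 P)
    {F : α → ℝ → ℝ} (hFp : MemLp (Function.uncurry F) 2 (ν.prod volume))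
    (hF2 : ∀ s, MemLp (F s) 2 volume)
    {J : α → Ω → ℝ} (hJ : StronglyMeasurable (Function.uncurry J))
    (hJF : ∀ s, J s =ᵐ[P] Φ ((hF2 s).toLp (F s))) :
    Integrable (Function.uncurry J) (ν.prod P) := by
  have hJ2 : ∀ s, MemLp (J s) 2 P := fun s => (memLp_congr_ae (hJF s)).2 (Lp.memLp _)
  refine (integrable_prod_iff hJ.aestronglyMeasurable).2
    ⟨.of_forall fun s => (hJ2 s).integrable one_le_two, ?_⟩
  have h1 : Integrable (fun s => ∫ u, F s u ^ 2) ν := hFp.integrable_sq.integral_prod_left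
  refine ((integrable_const (1 : ℝ)).add (h1.const_mul (‖Φ‖ ^ 2))).mono'
    hJ.norm.integral_prod_right'.aestronglyMeasurable (.of_forall fun s => ?_)
  rw [Real.norm_of_nonneg (integral_nonneg fun _ => norm_nonneg _)]
  have h2 : ∫ ω, J s ω ^ 2 ∂P ≤ ‖Φ‖ ^ 2 * ∫ u, F s u ^ 2 := by
    rw [integral_sq_eq_norm_sq (hJF s), integral_sq_eq_norm_sq (hF2 s).coeFn_toLp.symm, ← mul_pow]
    exact pow_le_pow_left₀ (norm_nonneg _) (Φ.le_opNorm _) 2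
  calc ∫ ω, ‖J s ω‖ ∂P ≤ ∫ ω, (1 + J s ω ^ 2) ∂P := by
        refine integral_mono ((hJ2 s).integrable one_le_two).norm
          ((integrable_const _).add (hJ2 s).integrable_sq) fun ω => ?_
        simp only [Real.norm_eq_abs]
        nlinarith [sq_abs (J s ω), sq_nonneg (|J s ω| - 1), abs_nonneg (J s ω)]
    _ = 1 + ∫ ω, J s ω ^ 2 ∂P := by
        rw [integral_add (integrable_const _) (hJ2 s).integrable_sq]
        simp
    _ ≤ _ := by
        simp only [Pi.add_apply]
        linarith

/-- Fubini's theorem for a continuous linear operator on `L²`. -/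
theorem integral_version_ae_eq (Φ : Lp ℝ 2 (volume : Measure ℝ) →L[ℝ] Lp ℝ 2 P)
    {F : α → ℝ → ℝ} (hFp : MemLp (Function.uncurry F) 2 (ν.prod volume))
    (hF2 : ∀ s, MemLp (F s) 2 volume) (hG : MemLp (fun u => ∫ s, F s u ∂ν) 2 volume)
    {J : α → Ω → ℝ} (hJ : StronglyMeasurable (Function.uncurry J))
    (hJF : ∀ s, J s =ᵐ[P] Φ ((hF2 s).toLp (F s))) :
    (fun ω => ∫ s, J s ω ∂ν) =ᵐ[P] Φ (hG.toLp _) := by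
  have hJi := integrable_uncurry_version Φ hFp hF2 hJ hJF
  refine Integrable.ae_eq_of_forall_setIntegral_eq _ _ hJi.integral_prod_right
    ((Lp.memLp _).integrable one_le_two) fun A hA hPA => ?_
  -- `g = Φ* 1_A` turns integrals of `Φ f` over `A` into pairings of `g` with `f`. As `ν` is finite,
  -- `g` is square integrable on the product too, so `g u * F s u` is integrable there.
  set g : Lp ℝ 2 (volume : Measure ℝ) := ContinuousLinearMap.adjoint Φ
    (indicatorConstLp 2 hA hPA.ne 1)
  have hadj : ∀ {f : ℝ → ℝ} (hf : MemLp f 2 volume),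
      ∫ ω in A, Φ (hf.toLp f) ω ∂P = ∫ u, g u * f u := by
    intro f hf
    rw [← L2.inner_indicatorConstLp_one (𝕜 := ℝ) hA hPA.ne,
      ← ContinuousLinearMap.adjoint_inner_left, L2.inner_def]
    refine integral_congr_ae ?_
    filter_upwards [hf.coeFn_toLp] with u hu
    rw [hu]
    simp [g, mul_comm]
  have hJA : Integrable (Function.uncurry J) (ν.prod (P.restrict A)) := by
    refine hJi.mono_measure ?_
    conv_lhs => rw [← Measure.restrict_univ (μ := ν), Measure.prod_restrict]
    exact Measure.restrict_le_self
  have hgF : Integrable (Function.uncurry fun s u => g u * F s u) (ν.prod volume) :=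
    ((Lp.memLp g).comp_snd ν).integrable_mul hFp
  calc ∫ ω in A, ∫ s, J s ω ∂ν ∂P = ∫ s, ∫ ω in A, J s ω ∂P ∂ν :=
        (integral_integral_swap hJA).symm
    _ = ∫ s, (∫ u, g u * F s u) ∂ν := by
        refine integral_congr_ae (.of_forall fun s => ?_)
        exact (setIntegral_congr_ae hA ((hJF s).mono fun ω h _ => h)).trans (hadj (hF2 s))
    _ = ∫ u, (∫ s, g u * F s u ∂ν) := integral_integral_swap hgF
    _ = ∫ u, g u * ∫ s, F s u ∂ν := by simp_rw [integral_const_mul]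
    _ = _ := (hadj hG).symm

end MeasurableVersion

/-! ### Bounded families, modifications and null sets -/

/-- A bounded integrable function is square integrable. -/
theorem MeasureTheory.Integrable.memLp_two_of_bound {α E : Type*} [MeasurableSpace α]
    {ν : Measure α} [NormedAddCommGroup E] {f : α → E} (hf : Integrable f ν) {C : ℝ}
    (hC : ∀ᵐ x ∂ν, ‖f x‖ ≤ C) : MemLp f 2 ν := by
  refine (memLp_two_iff_integrable_sq_norm hf.1).2 ?_
  refine (hf.norm.const_mul C).mono' (hf.1.norm.pow 2) ?_
  filter_upwards [hC] with x hx
  rw [norm_pow, norm_norm, sq]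
  exact mul_le_mul_of_nonneg_right hx (norm_nonneg _)

theorem scalarIntegral_congr {Ω : Type*} [MeasurableSpace Ω] {P : Measure Ω}
    (Φ : Lp ℝ 2 (volume : Measure ℝ) →L[ℝ] Lp ℝ 2 P) (μ : ℝ) {f g : ℝ → ℝ}
    (hf : MemLp f 2 volume) (hg : MemLp g 2 volume) (hfg : f =ᵐ[volume] g) :
    scalarIntegral Φ μ f hf = scalarIntegral Φ μ g hg := by
  ext ω
  rw [scalarIntegral, scalarIntegral, MemLp.toLp_congr hf hg hfg, integral_congr_ae hfg]

/-- A family of functions whose members are almost surely in `L²` has a jointly measurable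
modification all of whose members are in `L²`. -/
theorem exists_stronglyMeasurable_memLp_modification {α E : Type*} [MeasurableSpace α]
    {ν : Measure α} [SFinite ν] [NormedAddCommGroup E] {F : α → ℝ → E}
    (hF : AEStronglyMeasurable (Function.uncurry F) (ν.prod volume))
    (hF2 : ∀ᵐ s ∂ν, MemLp (F s) 2 volume) :
    ∃ F' : α → ℝ → E, StronglyMeasurable (Function.uncurry F') ∧
      (∀ s, MemLp (F' s) 2 volume) ∧
      Function.uncurry F =ᵐ[ν.prod volume] Function.uncurry F' := by
  classical
  set F₀ := hF.mk (Function.uncurry F)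
  have hF₀ : StronglyMeasurable F₀ := hF.stronglyMeasurable_mk
  have hFF₀ : Function.uncurry F =ᵐ[ν.prod volume] F₀ := hF.ae_eq_mk
  -- `B` is measurable by Tonelli and has full measure, so setting the representative to zero off
  -- `B` changes it only on a null set.
  set B : Set α := {s | eLpNorm (fun u => F₀ (s, u)) 2 volume < ∞}
  have hB : MeasurableSet B := by
    refine measurableSet_lt ?_ measurable_const
    simp_rw [eLpNorm_eq_lintegral_rpow_enorm_toReal (p := 2) (by simp) (by simp)]
    refine Measurable.pow_const ?_ _
    exact Measurable.lintegral_prod_right' (hF₀.enorm.pow_const _)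
  have hBae : ∀ᵐ s ∂ν, s ∈ B := by
    filter_upwards [hF2, Measure.ae_ae_of_ae_prod hFF₀] with s h1 h2
    exact ((memLp_congr_ae h2).1 h1).2
  refine ⟨fun s u => (B ×ˢ univ).indicator F₀ (s, u),
    hF₀.indicator (hB.prod MeasurableSet.univ), fun s => ?_, ?_⟩
  · by_cases hs : s ∈ B
    · have h1 : (fun u : ℝ => (B ×ˢ univ).indicator F₀ (s, u)) = fun u => F₀ (s, u) := by
        ext u
        simp [hs]
      change MemLp (fun u : ℝ => (B ×ˢ univ).indicator F₀ (s, u)) 2 volume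
      rw [h1]
      exact ⟨(hF₀.comp_measurable measurable_prodMk_left).aestronglyMeasurable, hs⟩
    · have h1 : (fun u : ℝ => (B ×ˢ univ).indicator F₀ (s, u)) = fun u => 0 := by
        ext u
        simp [hs]
      change MemLp (fun u : ℝ => (B ×ˢ univ).indicator F₀ (s, u)) 2 volume
      rw [h1]
      exact MemLp.zero'
  · filter_upwards [hFF₀, Measure.quasiMeasurePreserving_fst.ae hBae] with q h1 h2
    rw [h1]
    change F₀ q = (B ×ˢ univ).indicator F₀ q
    rw [indicator_of_mem (mk_mem_prod h2 (mem_univ q.2))]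

/-- Two jointly measurable processes that are modifications of each other agree almost
everywhere. -/
theorem ae_eq_prod_of_ae_ae_eq {α β E : Type*} [MeasurableSpace α] [MeasurableSpace β]
    {ν : Measure α} {P : Measure β} [SFinite P] [TopologicalSpace E]
    [TopologicalSpace.MetrizableSpace E] {f g : α → β → E}
    (hf : AEStronglyMeasurable (Function.uncurry f) (ν.prod P))
    (hg : AEStronglyMeasurable (Function.uncurry g) (ν.prod P))
    (hfg : ∀ᵐ s ∂ν, f s =ᵐ[P] g s) :
    Function.uncurry f =ᵐ[ν.prod P] Function.uncurry g := by
  -- Passing from sections to the product needs a measurable equality set, hence the strongly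
  -- measurable representatives.
  have h1 : hf.mk (Function.uncurry f) =ᵐ[ν.prod P] hg.mk (Function.uncurry g) := by
    refine (Measure.ae_prod_iff_ae_ae (hf.stronglyMeasurable_mk.measurableSet_eq_fun
      hg.stronglyMeasurable_mk)).2 ?_
    filter_upwards [hfg, Measure.ae_ae_of_ae_prod hf.ae_eq_mk,
      Measure.ae_ae_of_ae_prod hg.ae_eq_mk] with s h2 h3 h4
    filter_upwards [h2, h3, h4] with ω h5 h6 h7
    rw [← h6, ← h7]
    exact h5
  exact hf.ae_eq_mk.trans (h1.trans hg.ae_eq_mk.symm)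

theorem ae_ae_swap_of_ae_prod {α β : Type*} [MeasurableSpace α] [MeasurableSpace β]
    {ν : Measure α} {P : Measure β} [SFinite ν] [SFinite P] {p : α × β → Prop}
    (h : ∀ᵐ z ∂ν.prod P, p z) : ∀ᵐ ω ∂P, ∀ᵐ s ∂ν, p (s, ω) :=
  Measure.ae_ae_of_ae_prod (Measure.measurePreserving_swap.quasiMeasurePreserving.ae h)

/-- The members of a bounded, uniformly absolutely integrable family are bounded in `L¹`. -/
theorem UniformlyAbsolutelyIntegrableOn.exists_integral_norm_le {d m : ℕ}
    {F : ℝ → ℝ → Matrix (Fin d) (Fin m) ℝ} {S : Set ℝ}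
    (hF : UniformlyAbsolutelyIntegrableOn F S) {C : ℝ} (hC : ∀ s ∈ S, ∀ u, ‖F s u‖ ≤ C) :
    ∃ M, ∀ s ∈ S, ∫ u, ‖F s u‖ ≤ M := by
  obtain ⟨N₀, hN₀⟩ := hF.2 1 one_pos
  set N := max N₀ 0
  refine ⟨C * (volume.real (Icc (-N) N)) + 1, fun s hs => ?_⟩
  have hint := (hF.1 s hs).norm
  have hcompl : (Icc (-N) N)ᶜ = {u : ℝ | N < |u|} := by
    ext u
    rw [mem_compl_iff, mem_Icc, ← abs_le, not_le]
    rfl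
  rw [← integral_add_compl (measurableSet_Icc (a := -N) (b := N)) hint, hcompl]
  refine add_le_add ?_ (hN₀ N (le_max_left _ _) s hs)
  calc ∫ u in Icc (-N) N, ‖F s u‖ ≤ ∫ u in Icc (-N) N, C :=
        integral_mono hint.integrableOn (integrable_const C) fun u => hC s hs u
    _ = _ := by simp [mul_comm]

/-! ### The stochastic Fubini theorem -/

section Levy

variable {Ω : Type*} [MeasurableSpace Ω] {P : Measure Ω} [IsProbabilityMeasure P] {d m : ℕ}
  {L : ℝ → Ω → EuclideanSpace ℝ (Fin m)}

theorem IsTwoSidedLevyProcess.exists_centredIntegral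
    (hL : IsTwoSidedLevyProcess L P) (hL1 : MemLp (L 1) 2 P) :
    ∃ (μ v : Fin m → ℝ) (Φ : Fin m → Lp ℝ 2 (volume : Measure ℝ) →L[ℝ] Lp ℝ 2 P),
      (∀ j, HasLevyMoments (fun t ω => L t ω j) P (μ j) (v j)) ∧ ∀ j s t, s ≤ t →
        Φ j (IocLp s t) =ᵐ[P] fun ω => L t ω j - L s ω j - (t - s) * μ j := by
  choose μ v hv h using hL.hasLevyMoments hL1
  choose Φ hΦ using fun j => (h j).exists_centredIntegral (hv j)
  exact ⟨μ, v, Φ, h, hΦ⟩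

theorem IsTwoSidedLevyProcess.levyIntegrable
    (hL : IsTwoSidedLevyProcess L P) (hL1 : MemLp (L 1) 2 P)
    {f : ℝ → Matrix (Fin d) (Fin m) ℝ} (hf1 : Integrable f volume) (hf2 : MemLp f 2 volume) :
    LevyIntegrable L P f := by
  obtain ⟨μ, v, Φ, h, hΦ⟩ := hL.exists_centredIntegral hL1
  exact ⟨fun ω => WithLp.toLp 2 fun r =>
    ∑ j, scalarIntegral (Φ j) (μ j) _ (hf2.matrixEntry r j) ω,
    isLevyIntegral_of_ae_eq h hΦ hf1 hf2 fun r => by rfl⟩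

theorem IsLevyIntegral.ae_eq_levyIntegral
    (hL : IsTwoSidedLevyProcess L P) (hL1 : MemLp (L 1) 2 P)
    {f : ℝ → Matrix (Fin d) (Fin m) ℝ} {I : Ω → EuclideanSpace ℝ (Fin d)}
    (hI : IsLevyIntegral L P f I) : I =ᵐ[P] levyIntegral L P f := by
  have hf : LevyIntegrable L P f := ⟨I, hI⟩
  obtain ⟨μ, v, Φ, h, -⟩ := hL.exists_centredIntegral hL1
  rw [levyIntegral, dif_pos hf]
  exact IsLevyIntegral.ae_eq
    (fun t => (MemLp.of_eval_piLp (p := 2) fun j => (h j).memLp t).1) hI hf.choose_spec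

/-- Stochastic Fubini theorem: there is a jointly measurable version of the integral process with
integrable paths, whose path integral is the stochastic integral of the integrated integrand. -/
theorem IsTwoSidedLevyProcess.exists_version_integral
    (hL : IsTwoSidedLevyProcess L P) (hL1 : MemLp (L 1) 2 P)
    {ν : Measure ℝ} [IsFiniteMeasure ν] {F : ℝ → ℝ → Matrix (Fin d) (Fin m) ℝ}
    (hF1 : Integrable (Function.uncurry F) (ν.prod volume))
    (hF2 : MemLp (Function.uncurry F) 2 (ν.prod volume))
    (hFs : ∀ᵐ s ∂ν, MemLp (F s) 2 volume)
    (hG2 : MemLp (fun u => ∫ s, F s u ∂ν) 2 volume) :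
    ∃ J : ℝ → Ω → EuclideanSpace ℝ (Fin d), StronglyMeasurable (Function.uncurry J) ∧
      (∀ᵐ s ∂ν, IsLevyIntegral L P (F s) (J s)) ∧
      (∀ᵐ ω ∂P, Integrable (fun s => J s ω) ν) ∧
      IsLevyIntegral L P (fun u => ∫ s, F s u ∂ν) (fun ω => ∫ s, J s ω ∂ν) := by
  obtain ⟨μ, v, Φ, h, hΦ⟩ := hL.exists_centredIntegral hL1
  -- The construction of `J` needs every section in `L²`, not just almost every one.
  obtain ⟨F', hF'm, hF's, hFF'⟩ := exists_stronglyMeasurable_memLp_modification hF1.1 hFs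
  have hm : ∀ (r : Fin d) (j : Fin m),
      StronglyMeasurable (Function.uncurry fun s u => F' s u r j) := fun r j =>
    (matrixEntry r j).continuous.comp_stronglyMeasurable hF'm
  choose J hJm hJ using fun (r : Fin d) (j : Fin m) =>
    exists_stronglyMeasurable_version (Φ j) (hm r j) fun s => (hF's s).matrixEntry r j
  have hF'1 : ∀ (r : Fin d) (j : Fin m),
      Integrable (Function.uncurry fun s u => F' s u r j) (ν.prod volume) := fun r j =>
    (matrixEntry r j).integrable_comp (hF1.congr hFF')
  have hF'2 : ∀ (r : Fin d) (j : Fin m),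
      MemLp (Function.uncurry fun s u => F' s u r j) 2 (ν.prod volume) := fun r j =>
    ((memLp_congr_ae hFF').1 hF2).matrixEntry r j
  have hGG' : ∀ (r : Fin d) (j : Fin m),
      (fun u => (∫ s, F s u ∂ν) r j) =ᵐ[volume] fun u => ∫ s, F' s u r j ∂ν := by
    intro r j
    filter_upwards [ae_ae_swap_of_ae_prod hFF', hF1.prod_left_ae] with u h1 h2
    refine (((matrixEntry r j).integral_comp_comm h2).symm).trans (integral_congr_ae ?_)
    filter_upwards [h1] with s h3
    exact congrArg (fun A : Matrix (Fin d) (Fin m) ℝ => A r j) h3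
  have hG' : ∀ (r : Fin d) (j : Fin m), MemLp (fun u => ∫ s, F' s u r j ∂ν) 2 volume :=
    fun r j => (memLp_congr_ae (hGG' r j)).1 (hG2.matrixEntry r j)
  have hdrift : ∀ (r : Fin d) (j : Fin m), Integrable (fun s => μ j * ∫ u, F' s u r j) ν :=
    fun r j => (hF'1 r j).integral_prod_left.const_mul _
  have hpath : ∀ᵐ ω ∂P, ∀ r j, Integrable (fun s => J r j s ω) ν :=
    ae_all_iff.2 fun r => ae_all_iff.2 fun j => (integrable_uncurry_version (Φ j) (hF'2 r j)
      (fun s => (hF's s).matrixEntry r j) (hJm r j) (hJ r j)).prod_left_ae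
  set J₀ : ℝ → Ω → EuclideanSpace ℝ (Fin d) := fun s ω => WithLp.toLp 2 fun r =>
    ∑ j, (J r j s ω + μ j * ∫ u, F' s u r j)
  have hterm : ∀ᵐ ω ∂P, ∀ r j, Integrable (fun s => J r j s ω + μ j * ∫ u, F' s u r j) ν :=
    hpath.mono fun ω hω r j => (hω r j).add (hdrift r j)
  have hpath₀ : ∀ᵐ ω ∂P, Integrable (fun s => J₀ s ω) ν := by
    filter_upwards [hterm] with ω hω
    refine Integrable.of_eval_piLp fun r => ?_
    change Integrable (fun s => ∑ j, (J r j s ω + μ j * ∫ u, F' s u r j)) ν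
    exact integrable_finsetSum _ fun j _ => hω r j
  refine ⟨J₀, ?_, ?_, hpath₀, ?_⟩
  · have h1 : Measurable fun q : ℝ × Ω => fun r : Fin d =>
        ∑ j, (J r j q.1 q.2 + μ j * ∫ u, F' q.1 u r j) := by
      refine measurable_pi_lambda _ fun r => Finset.measurable_fun_sum _ fun j _ => ?_
      refine (hJm r j).measurable.add (Measurable.const_mul ?_ _)
      exact (hm r j).integral_prod_right'.measurable.comp measurable_fst
    exact ((WithLp.measurable_toLp 2 _).comp h1).stronglyMeasurable
  · filter_upwards [hFs, hF1.prod_right_ae, Measure.ae_ae_of_ae_prod hFF'] with s h2 h1 h3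
    refine isLevyIntegral_of_ae_eq h hΦ h1 h2 fun r => ?_
    filter_upwards [ae_all_iff.2 fun j => hJ r j s] with ω hω
    change ∑ j, (J r j s ω + μ j * ∫ u, F' s u r j) = _
    refine Finset.sum_congr rfl fun j _ => ?_
    rw [hω j]
    refine congrFun (scalarIntegral_congr (Φ j) (μ j) ((hF's s).matrixEntry r j)
      (h2.matrixEntry r j) ?_) ω
    filter_upwards [h3] with u hu
    exact (congrArg (fun A : Matrix (Fin d) (Fin m) ℝ => A r j) hu).symm
  · refine isLevyIntegral_of_ae_eq h hΦ hF1.integral_prod_right hG2 fun r => ?_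
    filter_upwards [hpath, hterm, hpath₀, ae_all_iff.2 fun j => integral_version_ae_eq (Φ j) (hF'2 r j)
      (fun s => (hF's s).matrixEntry r j) (hG' r j) (hJm r j) (hJ r j)] with ω h1 ht h2 h3
    have h4 : (∫ s, J₀ s ω ∂ν) r = ∫ s, ∑ j, (J r j s ω + μ j * ∫ u, F' s u r j) ∂ν :=
      ((EuclideanSpace.proj (𝕜 := ℝ) r).integral_comp_comm h2).symm
    rw [h4, integral_finsetSum _ fun j _ => ht r j]
    refine Finset.sum_congr rfl fun j _ => ?_
    -- The centred part is interchanged by `integral_version_ae_eq`, the drift by classical Fubini.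
    rw [integral_add (h1 r j) (hdrift r j), h3 j, integral_const_mul,
      integral_integral_swap (hF'1 r j)]
    exact congrFun (scalarIntegral_congr (Φ j) (μ j) (hG' r j) (hG2.matrixEntry r j)
      (hGG' r j).symm) ω

end Levy

theorem mainTheorem7 {Ω : Type*} [MeasurableSpace Ω] (P : Measure Ω) [IsProbabilityMeasure P]
    {d m : ℕ} (L : ℝ → Ω → EuclideanSpace ℝ (Fin m))
    (hL : IsTwoSidedLevyProcess L P) (hL2 : MemLp (L 1) 2 P)
    (a b : ℝ) (hab : a ≤ b) (F : ℝ → ℝ → Matrix (Fin d) (Fin m) ℝ)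
    (hF_meas : AEStronglyMeasurable (Function.uncurry F)
      ((volume.restrict (Icc a b)).prod volume))
    (hF_bdd : ∃ C : ℝ, ∀ s ∈ Icc a b, ∀ u, ‖F s u‖ ≤ C)
    (hF_int : UniformlyAbsolutelyIntegrableOn F (Icc a b))
    (hF_zero : ∀ ε > 0, ∃ N : ℝ, ∀ s ∈ Icc a b, ∀ u : ℝ, N < |u| → ‖F s u‖ ≤ ε) :
    (∀ s ∈ Icc a b, LevyIntegrable L P (F s)) ∧
    LevyIntegrable L P (fun u => ∫ s in a..b, F s u) ∧
    (∃ J : ℝ → Ω → EuclideanSpace ℝ (Fin d), IsMeasurableVersion L P a b F J) ∧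
    ∀ J : ℝ → Ω → EuclideanSpace ℝ (Fin d), IsMeasurableVersion L P a b F J →
      ∀ᵐ ω ∂P, IntervalIntegrable (fun s => J s ω) volume a b ∧
        ∫ s in a..b, J s ω = levyIntegral L P (fun u => ∫ s in a..b, F s u) ω := by
  obtain ⟨C, hC⟩ := hF_bdd
  obtain ⟨M, hM⟩ := hF_int.exists_integral_norm_le hC
  set ν : Measure ℝ := volume.restrict (Icc a b)
  have hν : ∀ᵐ s ∂ν, s ∈ Icc a b := ae_restrict_mem measurableSet_Icc
  have hFs : ∀ s ∈ Icc a b, MemLp (F s) 2 volume := fun s hs =>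
    (hF_int.1 s hs).memLp_two_of_bound (.of_forall (hC s hs))
  -- The bound `M` on the `L¹` norms is uniform in `s` and `[a, b]` has finite length; square
  -- integrability then follows from `‖F‖² ≤ C ‖F‖`.
  have hF1 : Integrable (Function.uncurry F) (ν.prod volume) := by
    refine (integrable_prod_iff hF_meas).2 ⟨hν.mono fun s hs => hF_int.1 s hs, ?_⟩
    refine (integrable_const M).mono' hF_meas.norm.integral_prod_right' (hν.mono fun s hs => ?_)
    rw [Real.norm_of_nonneg (integral_nonneg fun _ => norm_nonneg _)]
    exact hM s hs
  have hF2 : MemLp (Function.uncurry F) 2 (ν.prod volume) :=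
    hF1.memLp_two_of_bound (Measure.quasiMeasurePreserving_fst.ae
      (hν.mono fun s hs => (hC s hs : ∀ u, ‖F s u‖ ≤ C))|>.mono fun q hq => hq q.2)
  have hG1 : Integrable (fun u => ∫ s, F s u ∂ν) volume := hF1.integral_prod_right
  have hG2 : MemLp (fun u => ∫ s, F s u ∂ν) 2 volume :=
    hG1.memLp_two_of_bound (.of_forall fun u =>
      norm_integral_le_of_norm_le_const (hν.mono fun s hs => hC s hs u))
  have hinterval : ∀ {E : Type} [NormedAddCommGroup E] [NormedSpace ℝ E] (g : ℝ → E),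
      ∫ s in a..b, g s = ∫ s, g s ∂ν := fun g => by
    rw [intervalIntegral.integral_of_le hab, ← integral_Icc_eq_integral_Ioc]
  simp_rw [hinterval]
  obtain ⟨J₀, hJ₀m, hJ₀, hJ₀i, hJ₀G⟩ :=
    hL.exists_version_integral hL2 hF1 hF2 (hν.mono hFs) hG2
  have hJ₀v : ∀ᵐ s ∂ν, J₀ s =ᵐ[P] levyIntegral L P (F s) :=
    hJ₀.mono fun s hs => hs.ae_eq_levyIntegral hL hL2
  refine ⟨fun s hs => hL.levyIntegrable hL2 (hF_int.1 s hs) (hFs s hs),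
    hL.levyIntegrable hL2 hG1 hG2, ⟨J₀, hJ₀m.aestronglyMeasurable, hJ₀v⟩, fun J hJ => ?_⟩
  -- The exceptional null set of a version may depend on `s`; joint measurability permits exchanging
  -- "almost every `s`" and "almost every `ω`".
  have hJJ₀ : ∀ᵐ ω ∂P, (fun s => J s ω) =ᵐ[ν] fun s => J₀ s ω := by
    refine ae_ae_swap_of_ae_prod (ae_eq_prod_of_ae_ae_eq hJ.1 hJ₀m.aestronglyMeasurable ?_)
    filter_upwards [hJ.2, hJ₀v] with s h1 h2
    exact h1.trans h2.symm
  filter_upwards [hJJ₀, hJ₀i, hJ₀G.ae_eq_levyIntegral hL hL2] with ω h1 h2 h3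
  refine ⟨?_, (integral_congr_ae h1).trans h3⟩
  rw [intervalIntegrable_iff_integrableOn_Icc_of_le hab]
  exact h2.congr h1.symm
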